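/- **Setting.** Let $X\in\mathbb R^{d\times n}$, $y\in\{-1,1\}^n$, $Z=X\,\mathrm{diag}(y)$, let $e\in\mathbb R^n$ have positive entries with $\|e\|_\infty=1$, let $C>0$, $q>0$, and let $D=\mu I_d$ with $\mu>0$. Norms are Euclidean unless indicated. Put $\theta_q(t)=t^{-q}$ for $t>0$ and $\theta_q(t)=+\infty$ for $t\le 0$, let $B=\{u\in\mathbb R^d:\|u\|\le 1\}$, and let $\delta_S$ be the $0/{+\infty}$ indicator function of $S$. Consider the problem $$(P)\qquad \min_{r,w,\beta,\xi,u}\ \Phi:=\sum_{i=1}^n\theta_q(r_i)+C\langle e,\xi\rangle+\delta_B(u)+\delta_{\mathbb R^n_+}(\xi)\quad\text{s.t.}\quad Z^Tw+\beta y+\xi-r=0,\quad D(w-u)=0,$$ with $r,\xi\in\mathbb R^n$, $w,u\in\mathbb R^d$, $\beta\in\mathbb R$, and its Lagrangian dual $$(D)\qquad \max_{\alpha\in\mathbb R^n,\ \rho\in\mathbb R^d}\ \inf_{r,w,\beta,\xi,u}\big\{\Phi-\langle\alpha,Z^Tw+\beta y+\xi-r\rangle-\langle\rho,D(w-u)\rangle\big\}.$$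 A primal point is feasible if it satisfies the linear constraints and $\Phi<+\infty$; a pair $(\alpha,\rho)$ is dual feasible if the infimum in $(D)$ is $>-\infty$. **KKT system.** The KKT system in $(r,w,\beta,\xi,\alpha)$ is: $Z^Tw+\beta y+\xi-r=0$, $\langle y,\alpha\rangle=0$, $r>0$, $\alpha>0$, $\alpha\le Ce$, $\xi\ge0$, $\langle Ce-\alpha,\xi\rangle=0$, $\alpha_i=q/r_i^{q+1}$ for all $i$, and either $Z\alpha\ne0$ and $w=Z\alpha/\|Z\alpha\|$, or $Z\alpha=0$ and $\|w\|^2\le1$. **Algorithm (inexact sGS-ADMM).** Fix $\sigma>0$, $\tau\in(0,(1+\sqrt5)/2)$, a symmetric positive semidefinite $\mathcal T\in\mathbb R^{d\times d}$, and a summable nonincreasing sequence $\varepsilon_k\ge0$. Let $$A=\begin{bmatrix}ZZ^T+D^2+\mathcal T&Zy\\(Zy)^T&y^Ty\end{bmatrix},\qquad h^k(r)=\begin{bmatrix}-Z(\xi^k-r-\sigma^{-1}\alpha^k)+D^2u^k+\sigma^{-1}D\rho^k+\mathcal Tw^k\\-y^T(\xi^k-r-\sigma^{-1}\alpha^k)\end{bmatrix}.$$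 Start from a primal feasible $(r^0,w^0,\beta^0,\xi^0,u^0)$ and a dual feasible $(\alpha^0,\rho^0)$. For $k=0,1,2,\dots$: 1. (1a) choose $(\bar w,\bar\beta)$ with $\|h^k(r^k)-A[\bar w;\bar\beta]\|\le\varepsilon_k$; (1b) with $c=Z^T\bar w+\bar\beta y+\xi^k-\sigma^{-1}\alpha^k$, choose $r^{k+1}>0$ with $\big|-q/(r_i^{k+1})^{q+1}+\sigma(r_i^{k+1}-c_i)\big|\le\varepsilon_k/\sqrt n$ for all $i$; (1c) choose $(w^{k+1},\beta^{k+1})$ with $\|h^k(r^{k+1})-A[w^{k+1};\beta^{k+1}]\|\le5\varepsilon_k$. 2. With $g=w^{k+1}-\sigma^{-1}D^{-1}\rho^k$, set $u^{k+1}=g$ if $\|g\|\le1$ and $u^{k+1}=g/\|g\|$ otherwise; set $\xi^{k+1}=\max\{0,\ r^{k+1}-Z^Tw^{k+1}-\beta^{k+1}y+\sigma^{-1}\alpha^k-\sigma^{-1}Ce\}$ componentwise. 3. Set $\alpha^{k+1}=\alpha^k-\tau\sigma(Z^Tw^{k+1}+\beta^{k+1}y+\xi^{k+1}-r^{k+1})$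 and $\rho^{k+1}=\rho^k-\tau\sigma D(w^{k+1}-u^{k+1})$. **Theorem.** Suppose that the KKT system has at least one solution, and let $\{(r^k,w^k,\beta^k,\xi^k,u^k;\alpha^k,\rho^k)\}$ be any sequence generated by the algorithm. Then $(r^k,w^k,\beta^k,\xi^k,u^k)$ converges to an optimal solution of $(P)$, and $(\alpha^k,\rho^k)$ converges to an optimal solution of $(D)$. -/

import Mathlib

open Filter Topology

noncomputable section

namespace DWD

/-- `ℝᵐ` with the Euclidean norm and inner product. -/
abbrev Vec (m : ℕ) : Type := EuclideanSpace ℝ (Fin m)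

/-- The matrix-vector product `M v`, as a vector of the Euclidean space. -/
def mv {a b : ℕ} (M : Matrix (Fin a) (Fin b) ℝ) (v : Vec b) : Vec a :=
  Matrix.toEuclideanLin M v

/-- The data of a generalized distance weighted discrimination problem: feature vectors `x_i` (the
columns of `X`), labels `y_i ∈ {-1, 1}`, a positive weight vector `e` normalized by `‖e‖_∞ = 1`, a
penalty parameter `C > 0`, an exponent `q > 0`, and the scaling `D = μ I` with `μ > 0`. -/
structure Problem (n d : ℕ) where
  X : Matrix (Fin d) (Fin n) ℝ
  y : Vec n
  e : Vec n
  C : ℝ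
  q : ℝ
  μ : ℝ
  y_label : ∀ i, y i = -1 ∨ y i = 1
  e_pos : ∀ i, 0 < e i
  e_norm : ‖(WithLp.ofLp e : Fin n → ℝ)‖ = 1
  C_pos : 0 < C
  q_pos : 0 < q
  μ_pos : 0 < μ

/-- A point `(r, w, β, ξ, u)` of the space of primal variables. -/
structure Primal (n d : ℕ) where
  r : Vec n
  w : Vec d
  β : ℝ
  ξ : Vec n
  u : Vec d

/-- A pair of multipliers `(α, ρ)`. -/
structure Dual (n d : ℕ) where
  α : Vec n
  ρ : Vec d

/-- `θ_q(t) = 1 / t ^ q` for `t > 0`, and `∞` for `t ≤ 0`. -/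
def theta (q t : ℝ) : EReal :=
  if 0 < t then ((1 / t ^ q : ℝ) : EReal) else ⊤

open Classical in
/-- The infinity indicator function `δ_S`. -/
def infIndicator {E : Type*} (S : Set E) (x : E) : EReal :=
  if x ∈ S then 0 else ⊤

namespace Problem

variable {n d : ℕ}

/-- `Z = X diag(y)`. -/
def Z (P : Problem n d) : Matrix (Fin d) (Fin n) ℝ :=
  P.X * Matrix.diagonal (WithLp.ofLp P.y)

/-- `D = μ I`. -/
def D (P : Problem n d) : Matrix (Fin d) (Fin d) ℝ :=
  P.μ • (1 : Matrix (Fin d) (Fin d) ℝ)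

/-- `Zᵀ w + β y + ξ - r`. -/
def res1 (P : Problem n d) (x : Primal n d) : Vec n :=
  mv P.Z.transpose x.w + x.β • P.y + x.ξ - x.r

/-- `D (w - u)`. -/
def res2 (P : Problem n d) (x : Primal n d) : Vec d :=
  mv P.D (x.w - x.u)

/-- The objective `∑ θ_q(r_i) + C ⟨e, ξ⟩ + δ_B(u) + δ_{ℝⁿ₊}(ξ)`, `B` the closed unit ball. -/
def objective (P : Problem n d) (x : Primal n d) : EReal :=
  (∑ i, theta P.q (x.r i)) + ((P.C * inner ℝ P.e x.ξ : ℝ) : EReal)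
    + infIndicator (Metric.closedBall (0 : Vec d) 1) x.u
    + infIndicator {ξ : Vec n | ∀ i, 0 ≤ ξ i} x.ξ

/-- The linear constraints of the reformulated problem. -/
def Constraints (P : Problem n d) (x : Primal n d) : Prop :=
  P.res1 x = 0 ∧ P.res2 x = 0

/-- The feasible region: the linear constraints hold and the objective is finite
(that is, `r > 0`, `ξ ≥ 0` and `‖u‖ ≤ 1`). -/
def Feasible (P : Problem n d) (x : Primal n d) : Prop :=
  P.Constraints x ∧ P.objective x < ⊤

/-- Optimal solutions of the reformulated problem. -/
def IsOptimal (P : Problem n d) (x : Primal n d) : Prop :=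
  P.Feasible x ∧ ∀ x' : Primal n d, P.Constraints x' → P.objective x ≤ P.objective x'

/-- The Lagrangian, with the sign convention of the multipliers in the algorithm. -/
def lagrangian (P : Problem n d) (x : Primal n d) (m : Dual n d) : EReal :=
  P.objective x - ((inner ℝ m.α (P.res1 x) + inner ℝ m.ρ (P.res2 x) : ℝ) : EReal)

/-- The Lagrangian dual function. -/
def dualFunction (P : Problem n d) (m : Dual n d) : EReal :=
  ⨅ x : Primal n d, P.lagrangian x m

/-- The feasible region of the dual problem: the effective domain of the dual function. -/
def DualFeasible (P : Problem n d) (m : Dual n d) : Prop :=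
  ⊥ < P.dualFunction m

/-- Optimal solutions of the dual problem `max_{α, ρ} inf_x L(x; α, ρ)`. -/
def IsDualOptimal (P : Problem n d) (m : Dual n d) : Prop :=
  P.DualFeasible m ∧ ∀ m' : Dual n d, P.dualFunction m' ≤ P.dualFunction m

/-- The Karush-Kuhn-Tucker system of the original problem
`min { ∑ θ_q(r_i) + C ⟨e, ξ⟩ | Zᵀ w + β y + ξ - r = 0, ‖w‖ ≤ 1, ξ ≥ 0 }`. -/
def KKT (P : Problem n d) (r : Vec n) (w : Vec d) (β : ℝ) (ξ α : Vec n) : Prop :=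
  mv P.Z.transpose w + β • P.y + ξ - r = 0 ∧
  inner ℝ P.y α = 0 ∧
  (∀ i, 0 < r i) ∧
  (∀ i, 0 < α i) ∧
  (∀ i, α i ≤ P.C * P.e i) ∧
  (∀ i, 0 ≤ ξ i) ∧
  inner ℝ (P.C • P.e - α) ξ = 0 ∧
  (∀ i, α i = P.q / (r i) ^ (P.q + 1)) ∧
  ((mv P.Z α ≠ 0 ∧ w = ‖mv P.Z α‖⁻¹ • mv P.Z α) ∨ (mv P.Z α = 0 ∧ ‖w‖ ^ 2 ≤ 1))

end Problem

/-- The parameters of the algorithm: the penalty `σ > 0`, the steplength `τ ∈ (0, (1 + √5) / 2)`,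
the symmetric positive semidefinite matrix `T`, and the summable, nonincreasing sequence of
nonnegative tolerances `ε`. -/
structure Params (d : ℕ) where
  σ : ℝ
  τ : ℝ
  T : Matrix (Fin d) (Fin d) ℝ
  ε : ℕ → ℝ
  σ_pos : 0 < σ
  τ_pos : 0 < τ
  τ_lt : τ < (1 + √5) / 2
  T_posSemidef : T.PosSemidef
  ε_nonneg : ∀ k, 0 ≤ ε k
  ε_antitone : Antitone ε
  ε_summable : Summable ε

section Algorithm

variable {n d : ℕ}

/-- The `w`-block of the residual `h - A [w; β]`, where
`A = [Z Zᵀ + D² + T, Z y; (Z y)ᵀ, yᵀ y]` and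
`h = [-Z (ξ - r - σ⁻¹ α) + D² u + D (σ⁻¹ ρ) + T w₀; -yᵀ (ξ - r - σ⁻¹ α)]`. -/
def linResW (P : Problem n d) (A : Params d) (r ξ : Vec n) (u w₀ : Vec d) (m : Dual n d)
    (w : Vec d) (β : ℝ) : Vec d :=
  (-(mv P.Z (ξ - r - A.σ⁻¹ • m.α)) + mv (P.D ^ 2) u + mv P.D (A.σ⁻¹ • m.ρ) + mv A.T w₀)
    - (mv (P.Z * P.Z.transpose + P.D ^ 2 + A.T) w + β • mv P.Z P.y)

/-- The `β`-component of the residual `h - A [w; β]`. -/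
def linResβ (P : Problem n d) (A : Params d) (r ξ : Vec n) (m : Dual n d)
    (w : Vec d) (β : ℝ) : ℝ :=
  -(inner ℝ P.y (ξ - r - A.σ⁻¹ • m.α))
    - (inner ℝ (mv P.Z P.y) w + inner ℝ P.y P.y * β)

/-- The Euclidean norm of the residual `h - A [w; β]` in `ℝ^(d+1)`. -/
def linResNorm (P : Problem n d) (A : Params d) (r ξ : Vec n) (u w₀ : Vec d) (m : Dual n d)
    (w : Vec d) (β : ℝ) : ℝ :=
  √(‖linResW P A r ξ u w₀ m w β‖ ^ 2 + (linResβ P A r ξ m w β) ^ 2)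

/-- `(x', m')` is an admissible outcome of one iteration of the inexact sGS-ADMM that starts from
`(x, m)` and uses the tolerance `ε`; `(w₁, β₁)` is the intermediate pair `(w̄, β̄)`. -/
def IsStep (P : Problem n d) (A : Params d) (ε : ℝ) (x : Primal n d) (m : Dual n d)
    (x' : Primal n d) (m' : Dual n d) : Prop :=
  ∃ (w₁ : Vec d) (β₁ : ℝ),
    -- Step 1a
    linResNorm P A x.r x.ξ x.u x.w m w₁ β₁ ≤ ε ∧
    -- Step 1b
    (∀ i, 0 < x'.r i ∧
      |-(P.q / (x'.r i) ^ (P.q + 1))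
        + A.σ * (x'.r i - (mv P.Z.transpose w₁ + β₁ • P.y + x.ξ - A.σ⁻¹ • m.α) i)|
        ≤ ε / √(n : ℝ)) ∧
    -- Step 1c
    linResNorm P A x'.r x.ξ x.u x.w m x'.w x'.β ≤ 5 * ε ∧
    -- Step 2
    (let g : Vec d := x'.w - A.σ⁻¹ • mv P.D⁻¹ m.ρ
     x'.u = if ‖g‖ ≤ 1 then g else ‖g‖⁻¹ • g) ∧
    (∀ i, x'.ξ i = max 0
      ((x'.r - mv P.Z.transpose x'.w - x'.β • P.y + A.σ⁻¹ • m.α - (A.σ⁻¹ * P.C) • P.e) i)) ∧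
    -- Step 3
    m'.α = m.α - (A.τ * A.σ) • P.res1 x' ∧
    m'.ρ = m.ρ - (A.τ * A.σ) • P.res2 x'

/-- The sequences generated by the inexact sGS-ADMM: the initial iterate is primal and dual
feasible, and each iterate is an admissible outcome of one iteration. -/
structure IsGenerated (P : Problem n d) (A : Params d)
    (x : ℕ → Primal n d) (m : ℕ → Dual n d) : Prop where
  primal_init : P.Feasible (x 0)
  dual_init : P.DualFeasible (m 0)
  step : ∀ k, IsStep P A (A.ε k) (x k) (m k) (x (k + 1)) (m (k + 1))

end Algorithm

end DWD

end

/-! Group the variables as `y = (r, w, β)` and `z = (ξ, u)`, so that the constraints read `F y + G z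
= 0`. With `Q (w, β) = Zᵀ w + β y` and `A` the matrix of the linear system, the sweep "predict `(w,
β)`, update `r`, correct `(w, β)`" is one proximal step in the whole block `y`. Its proximal
operator is block diagonal: `σ Q A⁻¹ Qᵀ` on `r` and `σ T` on `w`. The three inexact solves merge
into one perturbation of the stationarity condition, bounded by a multiple of `ε k`
(`exists_perturbation`). The `z`-step is exact (`step_mem_graphG`). The algorithm is therefore an
inexact semi-proximal two-block ADMM with summable errors.

For such a method, monotonicity of the two subdifferentials gives a Lyapunov function, relative to
any solution, that decreases up to the perturbation (`lyap_descent`); the golden ratio bound on `τ`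
is what keeps the coefficients of the decrease positive. The perturbation enters multiplied by the
distance to the solution, hence by the square root of the Lyapunov function plus the decrease, and
summability makes the sequence quasi-Fejér. Iterates are bounded, residuals and increments vanish,
every cluster point is a solution by closedness of the graphs, and the descent relative to a cluster
point forces the whole sequence to converge to it (`exists_isSol_tendsto`).

A KKT solution provides the reference solution (`isSol_of_KKT`). Conversely, a solution of the
limiting inclusions is a saddle point of the Lagrangian, hence optimal for both problems
(`isOptimal_of_isSol`). -/

namespace DWD

open scoped InnerProductSpace

/-! ### Perturbed descent of nonnegative sequences -/

section Sequences

theorem le_sqrt_add_of_sq_le {a b s : ℝ} (ha : 0 ≤ a) (hb : 0 ≤ b) (h : s ^ 2 ≤ a + b * s) :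
    s ≤ √a + b := by
  by_contra! hlt
  have h0 := Real.sqrt_nonneg a
  have h1 : √a * √a = a := Real.mul_self_sqrt ha
  nlinarith [mul_pos (sub_pos.2 hlt) (show 0 < s by linarith)]

/-- One step of a perturbed descent, in terms of square roots. -/
theorem sqrt_add_le_of_descent {a p b : ℕ → ℝ} (ha : ∀ k, 0 ≤ a k) (hp : ∀ k, 0 ≤ p k)
    (hb : ∀ k, 0 ≤ b k)
    (h : ∀ k, a (k + 1) + p k ≤ a k + b k * √(a (k + 1) + p k)) (k : ℕ) :
    √(a (k + 1) + p k) ≤ √(a k) + b k := by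
  apply le_sqrt_add_of_sq_le (ha k) (hb k)
  rw [Real.sq_sqrt (add_nonneg (ha _) (hp _))]
  exact h k

/-- In terms of `√a` the perturbation is additive, so it telescopes. The arbitrary starting index
`j` leaves only the sum of the `b i` from `j` on, which is small for large `j`. -/
theorem sqrt_le_sqrt_add_sum_of_descent {a p b : ℕ → ℝ} (ha : ∀ k, 0 ≤ a k) (hp : ∀ k, 0 ≤ p k)
    (hb : ∀ k, 0 ≤ b k)
    (h : ∀ k, a (k + 1) + p k ≤ a k + b k * √(a (k + 1) + p k)) (j k : ℕ) :
    √(a (j + k)) ≤ √(a j) + ∑ i ∈ Finset.range k, b (i + j) := by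
  induction k with
  | zero => simp
  | succ k ih =>
    have h1 := sqrt_add_le_of_descent ha hp hb h (j + k)
    have h2 : √(a (j + k + 1)) ≤ √(a (j + k + 1) + p (j + k)) :=
      Real.sqrt_le_sqrt (by linarith [hp (j + k)])
    rw [Finset.sum_range_succ, ← add_assoc, add_comm k j]
    linarith

theorem exists_bound_of_descent {a p b : ℕ → ℝ} (ha : ∀ k, 0 ≤ a k) (hp : ∀ k, 0 ≤ p k)
    (hb : ∀ k, 0 ≤ b k) (hs : Summable b)
    (h : ∀ k, a (k + 1) + p k ≤ a k + b k * √(a (k + 1) + p k)) :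
    ∃ M, ∀ k, √(a (k + 1) + p k) ≤ M := by
  refine ⟨√(a 0) + (∑' i, b i) + ∑' i, b i, fun k => ?_⟩
  have h1 := sqrt_add_le_of_descent ha hp hb h k
  have h2 := sqrt_le_sqrt_add_sum_of_descent ha hp hb h 0 k
  have h3 : ∑ i ∈ Finset.range k, b i ≤ ∑' i, b i := hs.sum_le_tsum _ fun i _ => hb i
  have h4 : b k ≤ ∑' i, b i := hs.le_tsum k fun i _ => hb i
  simp only [zero_add, add_zero] at h2
  linarith

/-- Once the square roots are bounded by `M`, the perturbation is at most `M * b k`; telescoping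
then makes `p` summable. -/
theorem tendsto_zero_of_descent {a p b : ℕ → ℝ} (ha : ∀ k, 0 ≤ a k) (hp : ∀ k, 0 ≤ p k)
    (hb : ∀ k, 0 ≤ b k) (hs : Summable b)
    (h : ∀ k, a (k + 1) + p k ≤ a k + b k * √(a (k + 1) + p k)) :
    Tendsto p atTop (𝓝 0) := by
  obtain ⟨M, hM⟩ := exists_bound_of_descent ha hp hb hs h
  have hsum : ∀ k, a k + ∑ i ∈ Finset.range k, p i ≤ a 0 + M * ∑ i ∈ Finset.range k, b i := by
    intro k
    induction k with
    | zero => simp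
    | succ k ih =>
      rw [Finset.sum_range_succ, Finset.sum_range_succ]
      nlinarith [h k, hM k, mul_le_mul_of_nonneg_left (hM k) (hb k)]
  have hM0 : 0 ≤ M := (Real.sqrt_nonneg _).trans (hM 0)
  refine (summable_of_sum_range_le (c := a 0 + M * ∑' i, b i) hp fun k => ?_).tendsto_atTop_zero
  have h3 : ∑ i ∈ Finset.range k, b i ≤ ∑' i, b i := hs.sum_le_tsum _ fun i _ => hb i
  nlinarith [hsum k, ha k, mul_le_mul_of_nonneg_left h3 hM0]

/-- A quasi-Fejér monotone sequence with a subsequence tending to zero tends to zero. -/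
theorem tendsto_zero_of_descent_of_subseq {a p b : ℕ → ℝ} (ha : ∀ k, 0 ≤ a k)
    (hp : ∀ k, 0 ≤ p k) (hb : ∀ k, 0 ≤ b k) (hs : Summable b)
    (h : ∀ k, a (k + 1) + p k ≤ a k + b k * √(a (k + 1) + p k))
    {s : ℕ → ℕ} (hsm : StrictMono s) (hsub : Tendsto (fun k => a (s k)) atTop (𝓝 0)) :
    Tendsto a atTop (𝓝 0) := by
  have key : Tendsto (fun k => √(a k)) atTop (𝓝 0) := by
    -- This quantity bounds `√a` at every index from `s k` on.
    have h1 : Tendsto (fun k => √(a (s k)) + ∑' i, b (i + s k)) atTop (𝓝 0) := by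
      have h2 := hsub.sqrt
      have h3 := (tendsto_sum_nat_add b).comp hsm.tendsto_atTop
      simpa using h2.add h3
    rw [Metric.tendsto_atTop]
    intro δ hδ
    obtain ⟨j, hj⟩ := (h1.eventually (gt_mem_nhds hδ)).exists
    refine ⟨s j, fun k hk => ?_⟩
    obtain ⟨l, rfl⟩ := Nat.exists_eq_add_of_le hk
    rw [Real.dist_eq, sub_zero, abs_of_nonneg (Real.sqrt_nonneg _)]
    have h4 := sqrt_le_sqrt_add_sum_of_descent ha hp hb h (s j) l
    have h5 : ∑ i ∈ Finset.range l, b (i + s j) ≤ ∑' i, b (i + s j) :=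
      ((summable_nat_add_iff (s j)).2 hs).sum_le_tsum _ fun i _ => hb _
    linarith
  have := key.pow 2
  simpa [Real.sq_sqrt (ha _)] using this

end Sequences

/-! ### Coercivity, and the abstract semi-proximal ADMM with its Lyapunov descent -/

/-- A continuous positive definite form that is homogeneous of degree two is coercive. -/
theorem exists_norm_sq_le_of_pos {E : Type*} [NormedAddCommGroup E] [NormedSpace ℝ E]
    [FiniteDimensional ℝ E] {f : E → ℝ} (hf : Continuous f)
    (hsmul : ∀ (t : ℝ) x, f (t • x) = t ^ 2 * f x) (hpos : ∀ x, x ≠ 0 → 0 < f x) :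
    ∃ c, 0 < c ∧ ∀ x, ‖x‖ ^ 2 ≤ c * f x := by
  have h0 : f 0 = 0 := by simpa using hsmul 0 0
  by_cases hne : (Metric.sphere (0 : E) 1).Nonempty
  · obtain ⟨x₀, hx₀, hmin⟩ := (isCompact_sphere (0 : E) 1).exists_isMinOn hne hf.continuousOn
    have hx0 : x₀ ≠ 0 := by
      rintro rfl
      simp at hx₀
    have hp := hpos x₀ hx0
    refine ⟨(f x₀)⁻¹, inv_pos.2 hp, fun x => ?_⟩
    by_cases hx : x = 0
    · simp [hx, h0]
    · have hn : 0 < ‖x‖ := norm_pos_iff.2 hx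
      have h1 : f x₀ ≤ f (‖x‖⁻¹ • x) := hmin (by simp [norm_smul, hn.ne'])
      rw [hsmul] at h1
      rw [inv_mul_eq_div, le_div_iff₀ hp]
      calc ‖x‖ ^ 2 * f x₀ ≤ ‖x‖ ^ 2 * (‖x‖⁻¹ ^ 2 * f x) := by gcongr
        _ = f x := by field_simp
  -- An empty unit sphere forces the space to be zero, so any constant works.
  · refine ⟨1, one_pos, fun x => ?_⟩
    have hx : x = 0 := by
      by_contra hx
      exact hne ⟨‖x‖⁻¹ • x, by simp [norm_smul, (norm_pos_iff.2 hx).ne']⟩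
    simp [hx, h0]

/-- The data of a semi-proximal alternating direction method of multipliers for
`0 ∈ Tf y - F' l`, `0 ∈ Tg z - G' l`, `F y + G z = 0`, with the proximal operator `S` in the
first block, penalty `σ` and steplength `τ`. -/
structure ADMM (Y W V : Type*) [NormedAddCommGroup Y] [InnerProductSpace ℝ Y]
    [NormedAddCommGroup W] [InnerProductSpace ℝ W] [NormedAddCommGroup V]
    [InnerProductSpace ℝ V] where
  F : Y →ₗ[ℝ] V
  F' : V →ₗ[ℝ] Y
  G : W →ₗ[ℝ] V
  G' : V →ₗ[ℝ] W
  S : Y →ₗ[ℝ] Y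
  σ : ℝ
  τ : ℝ
  Tf : Set (Y × Y)
  Tg : Set (W × W)
  F_adj : ∀ y l, ⟪F' l, y⟫_ℝ = ⟪l, F y⟫_ℝ
  G_adj : ∀ z l, ⟪G' l, z⟫_ℝ = ⟪l, G z⟫_ℝ
  S_symm : ∀ a b, ⟪S a, b⟫_ℝ = ⟪S b, a⟫_ℝ
  S_nonneg : ∀ a, 0 ≤ ⟪S a, a⟫_ℝ
  F_S_pos : ∀ y, y ≠ 0 → 0 < ⟪S y, y⟫_ℝ + ‖F y‖ ^ 2
  G_inj : ∀ z, G z = 0 → z = 0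
  σ_pos : 0 < σ
  τ_pos : 0 < τ
  τ_sq_lt : τ ^ 2 < 1 + τ
  Tf_closed : IsClosed Tf
  Tg_closed : IsClosed Tg
  Tf_mono : ∀ p ∈ Tf, ∀ q ∈ Tf, 0 ≤ ⟪p.2 - q.2, p.1 - q.1⟫_ℝ
  Tg_mono : ∀ p ∈ Tg, ∀ q ∈ Tg, 0 ≤ ⟪p.2 - q.2, p.1 - q.1⟫_ℝ

namespace ADMM

variable {Y W V : Type*} [NormedAddCommGroup Y] [InnerProductSpace ℝ Y]
    [NormedAddCommGroup W] [InnerProductSpace ℝ W] [NormedAddCommGroup V]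
    [InnerProductSpace ℝ V]

/-- The constraint residual. -/
def R (M : ADMM Y W V) (y : Y) (z : W) : V := M.F y + M.G z

/-- Solutions of the optimality system. -/
def IsSol (M : ADMM Y W V) (y : Y) (z : W) (l : V) : Prop :=
  M.R y z = 0 ∧ (y, M.F' l) ∈ M.Tf ∧ (z, M.G' l) ∈ M.Tg

/-- `y, z, l` is a run of the method with perturbations `Δ` in the first block. -/
structure IsRun (M : ADMM Y W V) (y : ℕ → Y) (z : ℕ → W) (l : ℕ → V) (Δ : ℕ → Y) : Prop where
  step_y : ∀ k, (y (k + 1), M.F' (l k - M.σ • M.R (y (k + 1)) (z k))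
    - M.S (y (k + 1) - y k) + Δ k) ∈ M.Tf
  step_z : ∀ k, (z (k + 1), M.G' (l k - M.σ • M.R (y (k + 1)) (z (k + 1)))) ∈ M.Tg
  step_l : ∀ k, l (k + 1) = l k - (M.τ * M.σ) • M.R (y (k + 1)) (z (k + 1))

/-- The Lyapunov function of the method, relative to a solution `(ys, zs, ls)`. -/
noncomputable def lyap (M : ADMM Y W V) (κ : ℝ) (ys : Y) (zs : W) (ls : V) (y : Y) (z : W)
    (l : V) : ℝ :=
  (M.τ * M.σ)⁻¹ * ‖l - ls‖ ^ 2 + M.σ * ‖M.G (z - zs)‖ ^ 2 + ⟪M.S (y - ys), y - ys⟫_ℝ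
    + κ * M.σ * ‖M.R y z‖ ^ 2

/-- A weighted Young inequality whose weights leave positive coefficients `1 - ν` and `2 - τ - κ` in
the descent. For `τ ≤ 1` equal weights suffice. For `τ ≥ 1` expand `(τ - 1) / τ * ‖τ u + v‖ ^ 2 ≥
0`; then `ν < 1` and `κ < 2 - τ` are each equivalent to `τ ^ 2 < 1 + τ`. -/
theorem exists_young (M : ADMM Y W V) : ∃ ν κ : ℝ, 0 ≤ κ ∧ ν < 1 ∧ κ < 2 - M.τ ∧
    ∀ u v : V, 2 * ((1 - M.τ) * ⟪u, v⟫_ℝ) ≤ ν * ‖u‖ ^ 2 + κ * ‖v‖ ^ 2 := by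
  have h0 := M.τ_pos
  have h1 := M.τ_sq_lt
  rcases le_total M.τ 1 with h | h
  · refine ⟨1 - M.τ, 1 - M.τ, by linarith, by linarith, by linarith, fun u v => ?_⟩
    have := norm_sub_sq_real u v
    nlinarith [sq_nonneg ‖u - v‖]
  · refine ⟨M.τ * (M.τ - 1), (M.τ - 1) / M.τ, div_nonneg (by linarith) h0.le, by nlinarith, ?_,
      fun u v => ?_⟩
    · rw [div_lt_iff₀ h0]
      nlinarith
    · have h2 := norm_add_sq_real (M.τ • u) v
      rw [norm_smul, inner_smul_left, Real.norm_of_nonneg h0.le] at h2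
      have h3 : 0 ≤ (M.τ - 1) / M.τ * ‖M.τ • u + v‖ ^ 2 :=
        mul_nonneg (div_nonneg (by linarith) h0.le) (sq_nonneg _)
      rw [h2] at h3
      have h4 : (M.τ - 1) / M.τ * ((M.τ * ‖u‖) ^ 2 + 2 * ((starRingEnd ℝ) M.τ * ⟪u, v⟫_ℝ)
          + ‖v‖ ^ 2) = M.τ * (M.τ - 1) * ‖u‖ ^ 2 + 2 * ((M.τ - 1) * ⟪u, v⟫_ℝ)
          + (M.τ - 1) / M.τ * ‖v‖ ^ 2 := by
        simp only [conj_trivial]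
        field_simp
      linarith

/-- Monotonicity of `Tg` between two consecutive `z`-steps: by the multiplier update, the two dual
arguments differ by `σ` times `(1 - τ)` times the old residual minus the new one. Both points must
come from a `z`-step, so the initial `z 0` is excluded and the indices start at `k + 1`. -/
theorem norm_cross_term_le (M : ADMM Y W V) {y z l Δ} (hr : M.IsRun y z l Δ) (k : ℕ) :
    ⟪M.G (z (k + 2) - z (k + 1)), M.R (y (k + 2)) (z (k + 2))⟫_ℝ ≤
      (1 - M.τ) * ⟪M.G (z (k + 2) - z (k + 1)), M.R (y (k + 1)) (z (k + 1))⟫_ℝ := by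
  have h := M.Tg_mono _ (hr.step_z (k + 1)) _ (hr.step_z k)
  simp only [← map_sub, M.G_adj] at h
  rw [hr.step_l k] at h
  have h1 : l k - (M.τ * M.σ) • M.R (y (k + 1)) (z (k + 1))
      - M.σ • M.R (y (k + 1 + 1)) (z (k + 1 + 1)) - (l k - M.σ • M.R (y (k + 1)) (z (k + 1)))
      = M.σ • ((1 - M.τ) • M.R (y (k + 1)) (z (k + 1)) - M.R (y (k + 2)) (z (k + 2))) := by
    module
  rw [h1, inner_smul_left, conj_trivial, inner_sub_left, inner_smul_left, conj_trivial] at h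
  have h2 := nonneg_of_mul_nonneg_right h M.σ_pos
  rw [real_inner_comm] at h2
  rw [real_inner_comm, real_inner_comm _ (M.G _)]
  simp only [real_inner_comm] at *
  linarith

/-- Twice the monotonicity inequalities of `Tf` and `Tg` against the solution, plus `2 σ` times the
cross-term bound and `σ` times Young's inequality. The term `κ σ ‖R‖ ^ 2` of `lyap` is there to
absorb the old residual produced by Young. -/
theorem lyap_descent (M : ADMM Y W V) {ν κ : ℝ}
    (hY : ∀ u v : V, 2 * ((1 - M.τ) * ⟪u, v⟫_ℝ) ≤ ν * ‖u‖ ^ 2 + κ * ‖v‖ ^ 2)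
    {ys zs ls} (hs : M.IsSol ys zs ls) {y z l Δ} (hr : M.IsRun y z l Δ) (k : ℕ) :
    M.lyap κ ys zs ls (y (k + 2)) (z (k + 2)) (l (k + 2))
      + M.σ * (2 - M.τ - κ) * ‖M.R (y (k + 2)) (z (k + 2))‖ ^ 2
      + M.σ * (1 - ν) * ‖M.G (z (k + 2) - z (k + 1))‖ ^ 2
      + ⟪M.S (y (k + 2) - y (k + 1)), y (k + 2) - y (k + 1)⟫_ℝ
    ≤ M.lyap κ ys zs ls (y (k + 1)) (z (k + 1)) (l (k + 1))
      + 2 * ⟪Δ (k + 1), y (k + 2) - ys⟫_ℝ := by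
  obtain ⟨hs0, hsf, hsg⟩ := hs
  have hσ := M.σ_pos
  have hτ := M.τ_pos
  have h1 := M.Tf_mono _ (hr.step_y (k + 1)) _ hsf
  have h2 := M.Tg_mono _ (hr.step_z (k + 1)) _ hsg
  have h3 := M.norm_cross_term_le hr k
  have h4 := hY (M.G (z (k + 2) - z (k + 1))) (M.R (y (k + 1)) (z (k + 1)))
  have hl := hr.step_l (k + 1)
  simp only [add_assoc, Nat.reduceAdd] at h1 h2 hl
  unfold lyap
  rw [hl]
  generalize y (k + 1) = y0 at *
  generalize y (k + 2) = y1 at *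
  generalize z (k + 1) = z0 at *
  generalize z (k + 2) = z1 at *
  generalize l (k + 1) = l0 at *
  generalize Δ (k + 1) = Δ0 at *
  clear hl
  -- rewrite everything in terms of a few vectors
  obtain ⟨r1, hr1⟩ : ∃ r, r = M.R y1 z1 := ⟨_, rfl⟩
  obtain ⟨g0, hg0⟩ : ∃ g, g = M.G (z0 - zs) := ⟨_, rfl⟩
  obtain ⟨g1, hg1⟩ : ∃ g, g = M.G (z1 - zs) := ⟨_, rfl⟩
  obtain ⟨a0, ha0⟩ : ∃ a, a = y0 - ys := ⟨_, rfl⟩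
  obtain ⟨a1, ha1⟩ : ∃ a, a = y1 - ys := ⟨_, rfl⟩
  obtain ⟨e, he⟩ : ∃ e, e = l0 - ls := ⟨_, rfl⟩
  have hgd : M.G (z1 - z0) = g1 - g0 := by rw [hg1, hg0, ← map_sub]; congr 1; abel
  have had : y1 - y0 = a1 - a0 := by rw [ha1, ha0]; abel
  -- Feasibility of the solution eliminates `F`, so all inner products in the constraint space
  -- involve only `e`, `r1`, `g0` and `g1`.
  have hFa : M.F a1 = r1 - g1 := by
    rw [hr1, hg1, ha1, map_sub, map_sub]
    unfold R at hs0 ⊢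
    have : M.F ys = - M.G zs := eq_neg_of_add_eq_zero_left hs0
    rw [this]; abel
  have hR0 : M.R y1 z0 = r1 - (g1 - g0) := by
    rw [hr1, ← hgd, map_sub]; unfold R; abel
  have h1' : M.F' (l0 - M.σ • M.R y1 z0) - M.S (y1 - y0) + Δ0 - M.F' ls
      = M.F' (e - M.σ • (r1 - (g1 - g0))) - M.S (a1 - a0) + Δ0 := by
    rw [hR0, had, he, sub_right_comm l0, map_sub (M.F') _ ls]; abel
  have h2' : M.G' (l0 - M.σ • M.R y1 z1) - M.G' ls = M.G' (e - M.σ • r1) := by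
    rw [← hr1, he, ← map_sub]; congr 1; abel
  have hle : l0 - (M.τ * M.σ) • M.R y1 z1 - ls = e - (M.τ * M.σ) • r1 := by
    rw [← hr1, he]; abel
  rw [h1', ← ha1, inner_add_left, inner_sub_left, M.F_adj, hFa] at h1
  rw [h2', M.G_adj, ← hg1] at h2
  rw [hgd, ← hr1] at h3
  rw [hgd] at h4
  rw [hle, ← hr1, ← hg0, ← hg1, ← ha0, ← ha1, hgd, had, ← he]
  have hS := M.S_symm a0 a1
  have hn : ‖e - (M.τ * M.σ) • r1‖ ^ 2
      = ‖e‖ ^ 2 - 2 * (M.τ * M.σ) * ⟪e, r1⟫_ℝ + (M.τ * M.σ) ^ 2 * ‖r1‖ ^ 2 := by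
    rw [norm_sub_sq_real, inner_smul_right, norm_smul, mul_pow, Real.norm_eq_abs, sq_abs]; ring
  have hn' : (M.τ * M.σ)⁻¹ * ‖e - (M.τ * M.σ) • r1‖ ^ 2
      = (M.τ * M.σ)⁻¹ * ‖e‖ ^ 2 - 2 * ⟪e, r1⟫_ℝ + M.τ * M.σ * ‖r1‖ ^ 2 := by
    rw [hn]; field_simp
  have hg := norm_sub_sq_real g1 g0
  rw [hn']
  have h5 := mul_le_mul_of_nonneg_left h3 hσ.le
  have h6 := mul_le_mul_of_nonneg_left h4 hσ.le
  simp only [map_sub, inner_sub_left, inner_sub_right, inner_smul_left,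
    conj_trivial, real_inner_self_eq_norm_sq] at h1 h2 h5 h6 ⊢
  rw [hg] at h6 ⊢
  have c1 := real_inner_comm g0 g1
  have c2 := real_inner_comm g0 r1
  have c3 := real_inner_comm g1 r1
  simp only [c1, c3] at h1 h2 h5 h6 ⊢
  linarith

end ADMM
end DWD

namespace DWD
open scoped InnerProductSpace

/-! ### Convergence of the abstract method -/

namespace ADMM

variable {Y W V : Type*} [NormedAddCommGroup Y] [InnerProductSpace ℝ Y]
    [NormedAddCommGroup W] [InnerProductSpace ℝ W] [NormedAddCommGroup V]
    [InnerProductSpace ℝ V]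

theorem lyap_nonneg (M : ADMM Y W V) {κ : ℝ} (hκ : 0 ≤ κ) (ys : Y) (zs : W) (ls : V) (y : Y)
    (z : W) (l : V) : 0 ≤ M.lyap κ ys zs ls y z l := by
  have hσ := M.σ_pos
  have hτ := M.τ_pos
  have := M.S_nonneg (y - ys)
  unfold lyap
  positivity

theorem exists_norm_sq_le_F_S [FiniteDimensional ℝ Y] (M : ADMM Y W V) :
    ∃ c, 0 < c ∧ ∀ y, ‖y‖ ^ 2 ≤ c * (⟪M.S y, y⟫_ℝ + ‖M.F y‖ ^ 2) := by
  have hS := M.S.continuous_of_finiteDimensional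
  have hF := M.F.continuous_of_finiteDimensional
  apply exists_norm_sq_le_of_pos (by fun_prop) _ M.F_S_pos
  intro t x
  rw [map_smul, map_smul, inner_smul_left, inner_smul_right, norm_smul, mul_pow,
    Real.norm_eq_abs, sq_abs, conj_trivial]
  ring

theorem exists_norm_sq_le_G [FiniteDimensional ℝ W] (M : ADMM Y W V) :
    ∃ c, 0 < c ∧ ∀ z, ‖z‖ ^ 2 ≤ c * ‖M.G z‖ ^ 2 := by
  have hG := M.G.continuous_of_finiteDimensional
  apply exists_norm_sq_le_of_pos (f := fun z => ‖M.G z‖ ^ 2) (by fun_prop)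
  · intro t x
    simp only [map_smul, norm_smul, mul_pow, Real.norm_eq_abs, sq_abs]
  · intro z hz
    have : M.G z ≠ 0 := fun h => hz (M.G_inj z h)
    positivity

/-- The Lyapunov function together with the residual controls the distance to the solution. -/
theorem exists_norm_sq_le_lyap [FiniteDimensional ℝ Y] [FiniteDimensional ℝ W]
    (M : ADMM Y W V) {κ ω : ℝ} (hκ : 0 ≤ κ) (hω : 0 < ω) :
    ∃ c, 0 < c ∧ ∀ ys zs ls, M.R ys zs = 0 → ∀ y z l,
      ‖y - ys‖ ^ 2 ≤ c * (M.lyap κ ys zs ls y z l + ω * ‖M.R y z‖ ^ 2) ∧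
      ‖z - zs‖ ^ 2 ≤ c * (M.lyap κ ys zs ls y z l + ω * ‖M.R y z‖ ^ 2) ∧
      ‖l - ls‖ ^ 2 ≤ c * (M.lyap κ ys zs ls y z l + ω * ‖M.R y z‖ ^ 2) := by
  have hσ := M.σ_pos
  have hτ := M.τ_pos
  obtain ⟨cF, hcF, hF⟩ := M.exists_norm_sq_le_F_S
  obtain ⟨cG, hcG, hG⟩ := M.exists_norm_sq_le_G
  refine ⟨cF * (1 + 2 * ω⁻¹ + 2 * M.σ⁻¹) + cG * M.σ⁻¹ + M.τ * M.σ, by positivity, ?_⟩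
  intro ys zs ls hs y z l
  obtain ⟨q, hq⟩ : ∃ q, q = M.lyap κ ys zs ls y z l + ω * ‖M.R y z‖ ^ 2 := ⟨_, rfl⟩
  have hS := M.S_nonneg (y - ys)
  have t1 : 0 ≤ (M.τ * M.σ)⁻¹ * ‖l - ls‖ ^ 2 := by positivity
  have t2 : 0 ≤ M.σ * ‖M.G (z - zs)‖ ^ 2 := by positivity
  have t3 : 0 ≤ κ * M.σ * ‖M.R y z‖ ^ 2 := by positivity
  have t4 : 0 ≤ ω * ‖M.R y z‖ ^ 2 := by positivity
  have hq' := hq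
  unfold lyap at hq'
  have hq0 : 0 ≤ q := by linarith
  have b1 : ‖l - ls‖ ^ 2 ≤ M.τ * M.σ * q := by
    rw [← inv_mul_le_iff₀ (by positivity)]
    linarith
  have b2 : ‖M.G (z - zs)‖ ^ 2 ≤ M.σ⁻¹ * q := by
    rw [le_inv_mul_iff₀ hσ]
    linarith
  have b3 : ‖M.R y z‖ ^ 2 ≤ ω⁻¹ * q := by
    rw [le_inv_mul_iff₀ hω]
    linarith
  have b4 : ⟪M.S (y - ys), y - ys⟫_ℝ ≤ q := by linarith
  -- `lyap` sees `y` only through `S` and the residual; this identity recovers the missing control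
  -- of `F (y - ys)`, and `S` together with `F` is definite.
  have hFe : M.F (y - ys) = M.R y z - M.G (z - zs) := by
    unfold R at hs ⊢
    rw [map_sub, map_sub, eq_neg_of_add_eq_zero_left hs]; abel
  have b5 : ‖M.F (y - ys)‖ ^ 2 ≤ 2 * ‖M.R y z‖ ^ 2 + 2 * ‖M.G (z - zs)‖ ^ 2 := by
    rw [hFe]
    have h1 := norm_sub_sq_real (M.R y z) (M.G (z - zs))
    have h2 := norm_add_sq_real (M.R y z) (M.G (z - zs))
    nlinarith [sq_nonneg ‖M.R y z + M.G (z - zs)‖]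
  rw [← hq]
  have p1 : 0 ≤ cF * (1 + 2 * ω⁻¹ + 2 * M.σ⁻¹) * q := by positivity
  have p2 : 0 ≤ cG * M.σ⁻¹ * q := by positivity
  have p3 : 0 ≤ M.τ * M.σ * q := by positivity
  refine ⟨?_, ?_, by linarith⟩
  · calc ‖y - ys‖ ^ 2 ≤ cF * (⟪M.S (y - ys), y - ys⟫_ℝ + ‖M.F (y - ys)‖ ^ 2) := hF _
      _ ≤ cF * (q + (2 * (ω⁻¹ * q) + 2 * (M.σ⁻¹ * q))) := by gcongr; linarith
      _ ≤ _ := by linarith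
  · calc ‖z - zs‖ ^ 2 ≤ cG * ‖M.G (z - zs)‖ ^ 2 := hG _
      _ ≤ cG * (M.σ⁻¹ * q) := by gcongr
      _ ≤ _ := by linarith

/-- Limits of a run along a subsequence with vanishing residuals are solutions. -/
theorem isSol_of_tendsto [FiniteDimensional ℝ Y] [FiniteDimensional ℝ W] [FiniteDimensional ℝ V]
    (M : ADMM Y W V) {y z l Δ} (hr : M.IsRun y z l Δ)
    {s : ℕ → ℕ} {ys zs ls}
    (hy : Tendsto (fun k => y (s k + 1)) atTop (𝓝 ys))
    (hz : Tendsto (fun k => z (s k + 1)) atTop (𝓝 zs))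
    (hl : Tendsto (fun k => l (s k + 1)) atTop (𝓝 ls))
    (hΔ : Tendsto (fun k => Δ (s k)) atTop (𝓝 0))
    (hR : Tendsto (fun k => M.R (y (s k + 1)) (z (s k + 1))) atTop (𝓝 0))
    (hdy : Tendsto (fun k => y (s k + 1) - y (s k)) atTop (𝓝 0))
    (hdz : Tendsto (fun k => z (s k + 1) - z (s k)) atTop (𝓝 0)) : M.IsSol ys zs ls := by
  have cS := M.S.continuous_of_finiteDimensional
  have cF := M.F.continuous_of_finiteDimensional
  have cF' := M.F'.continuous_of_finiteDimensional
  have cG := M.G.continuous_of_finiteDimensional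
  have cG' := M.G'.continuous_of_finiteDimensional
  -- The `y`-inclusion involves the old multiplier and the residual at the old `z`. Vanishing
  -- residuals and increments give these the same limits as their new counterparts.
  have hl0 : Tendsto (fun k => l (s k)) atTop (𝓝 ls) := by
    have := hl.add (hR.const_smul (M.τ * M.σ))
    simp only [smul_zero, add_zero] at this
    refine this.congr fun k => ?_
    rw [hr.step_l]; abel
  have hR0 : Tendsto (fun k => M.R (y (s k + 1)) (z (s k))) atTop (𝓝 0) := by
    have := hR.sub ((cG.tendsto 0).comp hdz)
    simp only [map_zero, sub_zero] at this
    refine this.congr fun k => ?_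
    simp only [Function.comp, R, map_sub]; abel
  refine ⟨?_, ?_, ?_⟩
  · exact tendsto_nhds_unique (((cF.tendsto ys).comp hy).add ((cG.tendsto zs).comp hz)) hR
  · have h1 : Tendsto (fun k => M.F' (l (s k) - M.σ • M.R (y (s k + 1)) (z (s k)))
        - M.S (y (s k + 1) - y (s k)) + Δ (s k)) atTop (𝓝 (M.F' ls)) := by
      have h2 := ((cF'.tendsto _).comp (hl0.sub (hR0.const_smul M.σ)))
      have h3 := (h2.sub ((cS.tendsto 0).comp hdy)).add hΔ
      simpa [Function.comp_def] using h3
    exact M.Tf_closed.mem_of_tendsto (hy.prodMk_nhds h1)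
      (Eventually.of_forall fun k => hr.step_y (s k))
  · have h1 : Tendsto (fun k => M.G' (l (s k) - M.σ • M.R (y (s k + 1)) (z (s k + 1))))
        atTop (𝓝 (M.G' ls)) := by
      have h2 := ((cG'.tendsto _).comp (hl0.sub (hR.const_smul M.σ)))
      simpa [Function.comp_def] using h2
    exact M.Tg_closed.mem_of_tendsto (hz.prodMk_nhds h1)
      (Eventually.of_forall fun k => hr.step_z (s k))

theorem tendsto_zero_of_norm_sq_le {E : Type*} [SeminormedAddCommGroup E] {f : ℕ → E} {g : ℕ → ℝ}
    {c : ℝ} (h : ∀ k, ‖f k‖ ^ 2 ≤ c * g k) (hg : Tendsto g atTop (𝓝 0)) :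
    Tendsto f atTop (𝓝 0) := by
  have h1 : Tendsto (fun k => ‖f k‖ ^ 2) atTop (𝓝 0) :=
    squeeze_zero (fun k => by positivity) h (by simpa using hg.const_mul c)
  have h2 := h1.sqrt
  simp only [Real.sqrt_zero, Real.sqrt_sq (norm_nonneg _)] at h2
  exact tendsto_zero_iff_norm_tendsto_zero.2 h2

/-- Convergence of the inexact semi-proximal ADMM with steplength below the golden ratio. -/
theorem exists_isSol_tendsto [FiniteDimensional ℝ Y] [FiniteDimensional ℝ W]
    [FiniteDimensional ℝ V] (M : ADMM Y W V) (hsol : ∃ ys zs ls, M.IsSol ys zs ls)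
    {y z l Δ} (hr : M.IsRun y z l Δ) {ε : ℕ → ℝ} (hΔ : ∀ k, ‖Δ k‖ ≤ ε k) (hε : Summable ε) :
    ∃ ys zs ls, M.IsSol ys zs ls ∧ Tendsto y atTop (𝓝 ys) ∧ Tendsto z atTop (𝓝 zs) ∧
      Tendsto l atTop (𝓝 ls) := by
  have hσ := M.σ_pos
  have hε0 : ∀ k, 0 ≤ ε k := fun k => (norm_nonneg _).trans (hΔ k)
  obtain ⟨ν, κ, hκ, hν, hκ2, hY⟩ := M.exists_young
  have hω : 0 < M.σ * (2 - M.τ - κ) := mul_pos hσ (by linarith)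
  have hω' : 0 < M.σ * (1 - ν) := mul_pos hσ (by linarith)
  obtain ⟨c, hc, hcoer⟩ := M.exists_norm_sq_le_lyap hκ hω
  obtain ⟨cF, hcF, hF⟩ := M.exists_norm_sq_le_F_S
  obtain ⟨cG, hcG, hG⟩ := M.exists_norm_sq_le_G
  obtain ⟨p, hpdef⟩ : ∃ p : ℕ → ℝ, p = fun k =>
      M.σ * (2 - M.τ - κ) * ‖M.R (y (k + 2)) (z (k + 2))‖ ^ 2
      + M.σ * (1 - ν) * ‖M.G (z (k + 2) - z (k + 1))‖ ^ 2
      + ⟪M.S (y (k + 2) - y (k + 1)), y (k + 2) - y (k + 1)⟫_ℝ := ⟨_, rfl⟩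
  -- Cauchy–Schwarz on `2 * ⟪Δ, y - ys⟫`, with `‖y - ys‖` at most `√c` times the square root of
  -- `lyap` plus the decrease. The residual part of `p` is needed for this coercivity, which is why
  -- the descent lemmas use `√(a (k + 1) + p k)`.
  obtain ⟨b, hbdef⟩ : ∃ b : ℕ → ℝ, b = fun k => 2 * ε (k + 1) * √c := ⟨_, rfl⟩
  have hpk : ∀ k, p k = M.σ * (2 - M.τ - κ) * ‖M.R (y (k + 2)) (z (k + 2))‖ ^ 2
      + M.σ * (1 - ν) * ‖M.G (z (k + 2) - z (k + 1))‖ ^ 2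
      + ⟪M.S (y (k + 2) - y (k + 1)), y (k + 2) - y (k + 1)⟫_ℝ := fun k => by rw [hpdef]
  have q1 : ∀ k, 0 ≤ M.σ * (2 - M.τ - κ) * ‖M.R (y (k + 2)) (z (k + 2))‖ ^ 2 :=
    fun k => by positivity
  have q2 : ∀ k, 0 ≤ M.σ * (1 - ν) * ‖M.G (z (k + 2) - z (k + 1))‖ ^ 2 := fun k => by positivity
  have q3 := fun k => M.S_nonneg (y (k + 2) - y (k + 1))
  have hp : ∀ k, 0 ≤ p k := fun k => by rw [hpk]; linarith [q1 k, q2 k, q3 k]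
  have hb : ∀ k, 0 ≤ b k := fun k => by
    have := hε0 (k + 1)
    rw [hbdef]; positivity
  have hbs : Summable b := by
    rw [hbdef]
    exact (((summable_nat_add_iff 1).2 hε).mul_left 2).mul_right _
  have ha : ∀ ys zs ls, ∀ k, 0 ≤ M.lyap κ ys zs ls (y (k + 1)) (z (k + 1)) (l (k + 1)) :=
    fun ys zs ls k => M.lyap_nonneg hκ ..
  have hqp : ∀ ys zs ls k, M.lyap κ ys zs ls (y (k + 2)) (z (k + 2)) (l (k + 2))
      + M.σ * (2 - M.τ - κ) * ‖M.R (y (k + 2)) (z (k + 2))‖ ^ 2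
      ≤ M.lyap κ ys zs ls (y (k + 2)) (z (k + 2)) (l (k + 2)) + p k := fun ys zs ls k => by
    rw [hpk]; linarith [q2 k, q3 k]
  have hdesc : ∀ ys zs ls, M.IsSol ys zs ls → ∀ k,
      M.lyap κ ys zs ls (y (k + 1 + 1)) (z (k + 1 + 1)) (l (k + 1 + 1)) + p k ≤
      M.lyap κ ys zs ls (y (k + 1)) (z (k + 1)) (l (k + 1)) + b k *
        √(M.lyap κ ys zs ls (y (k + 1 + 1)) (z (k + 1 + 1)) (l (k + 1 + 1)) + p k) := by
    intro ys zs ls hs k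
    have h1 := M.lyap_descent hY hs hr k
    have h2 := (hcoer ys zs ls hs.1 (y (k + 2)) (z (k + 2)) (l (k + 2))).1.trans
      (mul_le_mul_of_nonneg_left (hqp ys zs ls k) hc.le)
    have h3 : ‖y (k + 2) - ys‖ ≤
        √c * √(M.lyap κ ys zs ls (y (k + 2)) (z (k + 2)) (l (k + 2)) + p k) := by
      rw [← Real.sqrt_mul hc.le]
      exact Real.le_sqrt_of_sq_le h2
    have h4 : ⟪Δ (k + 1), y (k + 2) - ys⟫_ℝ ≤ ε (k + 1) *
        (√c * √(M.lyap κ ys zs ls (y (k + 2)) (z (k + 2)) (l (k + 2)) + p k)) :=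
      (real_inner_le_norm _ _).trans
        (mul_le_mul (hΔ _) h3 (norm_nonneg _) (hε0 _))
    rw [hbdef, add_assoc k 1 1]
    norm_num only
    have := hpk k
    linarith
  obtain ⟨y₀, z₀, l₀, hs₀⟩ := hsol
  have hp0 := tendsto_zero_of_descent (ha y₀ z₀ l₀) hp hb hbs (hdesc _ _ _ hs₀)
  obtain ⟨B, hB⟩ := exists_bound_of_descent (ha y₀ z₀ l₀) hp hb hbs (hdesc _ _ _ hs₀)
  -- a convergent subsequence
  have hbd : ∀ k, (y (k + 2) - y₀, z (k + 2) - z₀, l (k + 2) - l₀) ∈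
      Metric.closedBall (0 : Y × W × V) (√(c * B ^ 2)) := by
    intro k
    have hq : M.lyap κ y₀ z₀ l₀ (y (k + 2)) (z (k + 2)) (l (k + 2))
        + M.σ * (2 - M.τ - κ) * ‖M.R (y (k + 2)) (z (k + 2))‖ ^ 2 ≤ B ^ 2 :=
      (hqp y₀ z₀ l₀ k).trans (Real.sqrt_le_left ((Real.sqrt_nonneg _).trans (hB k)) |>.1 (hB k))
    obtain ⟨h1, h2, h3⟩ := hcoer y₀ z₀ l₀ hs₀.1 (y (k + 2)) (z (k + 2)) (l (k + 2))
    have hq' := mul_le_mul_of_nonneg_left hq hc.le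
    rw [mem_closedBall_zero_iff, Prod.norm_def, Prod.norm_def]
    exact max_le (Real.le_sqrt_of_sq_le (h1.trans hq'))
      (max_le (Real.le_sqrt_of_sq_le (h2.trans hq')) (Real.le_sqrt_of_sq_le (h3.trans hq')))
  obtain ⟨⟨a₁, a₂, a₃⟩, -, s, hsm, hlim⟩ :=
    tendsto_subseq_of_bounded Metric.isBounded_closedBall hbd
  have hyl := (hlim.fst_nhds.add_const y₀)
  have hzl := (hlim.snd_nhds.fst_nhds.add_const z₀)
  have hll := (hlim.snd_nhds.snd_nhds.add_const l₀)
  simp only [Function.comp_def, sub_add_cancel] at hyl hzl hll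
  -- vanishing residuals
  have hR : Tendsto (fun k => M.R (y (k + 2)) (z (k + 2))) atTop (𝓝 0) := by
    refine tendsto_zero_of_norm_sq_le (c := (M.σ * (2 - M.τ - κ))⁻¹) (g := p) (fun k => ?_) hp0
    rw [le_inv_mul_iff₀ hω, hpk]
    linarith [q2 k, q3 k]
  have hGz : Tendsto (fun k => M.G (z (k + 2) - z (k + 1))) atTop (𝓝 0) := by
    refine tendsto_zero_of_norm_sq_le (c := (M.σ * (1 - ν))⁻¹) (g := p) (fun k => ?_) hp0
    rw [le_inv_mul_iff₀ hω', hpk]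
    linarith [q1 k, q3 k]
  have hdz : Tendsto (fun k => z (k + 2) - z (k + 1)) atTop (𝓝 0) := by
    refine tendsto_zero_of_norm_sq_le (fun k => hG _) ?_
    simpa using (hGz.norm.pow 2)
  -- The `S`-part of the increment is contained in `p`. Its image under `F` is a difference of two
  -- consecutive residuals minus a `G`-increment, whence the extra shift by one.
  have hdy : Tendsto (fun k => y (k + 1 + 2) - y (k + 1 + 1)) atTop (𝓝 0) := by
    refine tendsto_zero_of_norm_sq_le (c := cF) (g := fun k => p (k + 1)
      + ‖M.R (y (k + 1 + 2)) (z (k + 1 + 2)) - M.R (y (k + 2)) (z (k + 2))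
        - M.G (z (k + 1 + 2) - z (k + 1 + 1))‖ ^ 2) (fun k => ?_) ?_
    · refine (hF _).trans (mul_le_mul_of_nonneg_left ?_ hcF.le)
      have h1 : M.F (y (k + 1 + 2) - y (k + 1 + 1)) = M.R (y (k + 1 + 2)) (z (k + 1 + 2))
          - M.R (y (k + 2)) (z (k + 2)) - M.G (z (k + 1 + 2) - z (k + 1 + 1)) := by
        simp only [R, map_sub]; abel
      rw [h1, hpk (k + 1)]
      linarith [q1 (k + 1), q2 (k + 1)]
    · have h1 := (((tendsto_add_atTop_iff_nat 1).2 hR).sub hR).sub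
        ((tendsto_add_atTop_iff_nat 1).2 hGz)
      have h2 := ((tendsto_add_atTop_iff_nat 1).2 hp0).add (h1.norm.pow 2)
      simpa using h2
  have hdy' : Tendsto (fun k => y (k + 2) - y (k + 1)) atTop (𝓝 0) :=
    (tendsto_add_atTop_iff_nat 1).1 hdy
  have hΔ0 : Tendsto (fun k => Δ (k + 1)) atTop (𝓝 0) :=
    squeeze_zero_norm (fun k => hΔ _) ((tendsto_add_atTop_iff_nat 1).2 hε.tendsto_atTop_zero)
  have hsl : M.IsSol (a₁ + y₀) (a₂ + z₀) (a₃ + l₀) :=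
    M.isSol_of_tendsto hr (s := fun k => s k + 1) hyl hzl hll (hΔ0.comp hsm.tendsto_atTop)
      (hR.comp hsm.tendsto_atTop) (hdy'.comp hsm.tendsto_atTop) (hdz.comp hsm.tendsto_atTop)
  refine ⟨_, _, _, hsl, ?_⟩
  generalize a₁ + y₀ = y₁ at *
  generalize a₂ + z₀ = z₁ at *
  generalize a₃ + l₀ = l₁ at *
  have cS := M.S.continuous_of_finiteDimensional
  have cG := M.G.continuous_of_finiteDimensional
  have hsub : Tendsto (fun k => M.lyap κ y₁ z₁ l₁ (y (s k + 1 + 1)) (z (s k + 1 + 1))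
      (l (s k + 1 + 1))) atTop (𝓝 0) := by
    have e1 := (hll.sub_const l₁).norm.pow 2 |>.const_mul (M.τ * M.σ)⁻¹
    have e2 := ((cG.tendsto _).comp (hzl.sub_const z₁)).norm.pow 2 |>.const_mul M.σ
    have e3 := (((cS.tendsto _).comp (hyl.sub_const y₁))).inner (𝕜 := ℝ) (hyl.sub_const y₁)
    have e4 := ((hR.comp hsm.tendsto_atTop).norm.pow 2).const_mul (κ * M.σ)
    have e5 := ((e1.add e2).add e3).add e4
    simpa [Function.comp_def, lyap] using e5
  -- The descent holds relative to every solution, so it applies to the cluster point itself. The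
  -- Lyapunov sequence is indexed from the iterate `k + 1`, so the iterate `s k + 2` has index `s k
  -- + 1`.
  have hfin := tendsto_zero_of_descent_of_subseq (ha y₁ z₁ l₁) hp hb hbs (hdesc _ _ _ hsl)
    (s := fun k => s k + 1) (fun i j hij => by simpa using hsm hij) hsub
  have hq0 : Tendsto (fun k => M.lyap κ y₁ z₁ l₁ (y (k + 2)) (z (k + 2)) (l (k + 2))
      + M.σ * (2 - M.τ - κ) * ‖M.R (y (k + 2)) (z (k + 2))‖ ^ 2) atTop (𝓝 0) := by
    have h1 := ((tendsto_add_atTop_iff_nat 1).2 hfin).add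
      ((hR.norm.pow 2).const_mul (M.σ * (2 - M.τ - κ)))
    simpa using h1
  have hall := fun k => hcoer y₁ z₁ l₁ hsl.1 (y (k + 2)) (z (k + 2)) (l (k + 2))
  refine ⟨?_, ?_, ?_⟩ <;> rw [← tendsto_add_atTop_iff_nat 2, ← tendsto_sub_nhds_zero_iff]
  · exact tendsto_zero_of_norm_sq_le (fun k => (hall k).1) hq0
  · exact tendsto_zero_of_norm_sq_le (fun k => (hall k).2.1) hq0
  · exact tendsto_zero_of_norm_sq_le (fun k => (hall k).2.2) hq0

end ADMM
end DWD

noncomputable section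

namespace DWD
open scoped InnerProductSpace

/-! ### Matrix-vector algebra -/

section MatrixVector

variable {a b c : ℕ}

theorem mv_add (M : Matrix (Fin a) (Fin b) ℝ) (v w : Vec b) : mv M (v + w) = mv M v + mv M w :=
  map_add _ _ _

theorem mv_sub (M : Matrix (Fin a) (Fin b) ℝ) (v w : Vec b) : mv M (v - w) = mv M v - mv M w :=
  map_sub _ _ _

theorem mv_smul (M : Matrix (Fin a) (Fin b) ℝ) (t : ℝ) (v : Vec b) :
    mv M (t • v) = t • mv M v :=
  map_smul _ _ _

theorem add_mv (M N : Matrix (Fin a) (Fin b) ℝ) (v : Vec b) : mv (M + N) v = mv M v + mv N v := by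
  simp [mv]

theorem mul_mv (M : Matrix (Fin a) (Fin b) ℝ) (N : Matrix (Fin b) (Fin c) ℝ) (v : Vec c) :
    mv (M * N) v = mv M (mv N v) := by
  simp [mv, Matrix.toLpLin_apply, Matrix.mulVec_mulVec]

theorem smul_one_mv (t : ℝ) (v : Vec a) : mv (t • (1 : Matrix (Fin a) (Fin a) ℝ)) v = t • v := by
  simp [mv]

theorem inner_mv (M : Matrix (Fin a) (Fin b) ℝ) (v : Vec b) (w : Vec a) :
    ⟪mv M v, w⟫_ℝ = ⟪v, mv M.transpose w⟫_ℝ := by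
  have h : mv M.transpose w = LinearMap.adjoint (Matrix.toEuclideanLin M) w := by
    rw [← Matrix.toEuclideanLin_conjTranspose_eq_adjoint, Matrix.conjTranspose_eq_transpose_of_trivial]
    rfl
  rw [h, LinearMap.adjoint_inner_right]
  rfl

theorem inner_mv_self_nonneg {T : Matrix (Fin a) (Fin a) ℝ} (hT : T.PosSemidef) (v : Vec a) :
    0 ≤ ⟪mv T v, v⟫_ℝ := by
  have := (Matrix.isPositive_toEuclideanLin_iff.2 hT).2 v
  simpa [mv] using this

theorem inner_mv_comm {T : Matrix (Fin a) (Fin a) ℝ} (hT : T.PosSemidef) (v w : Vec a) :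
    ⟪mv T v, w⟫_ℝ = ⟪mv T w, v⟫_ℝ := by
  have h : T.transpose = T := by
    have := hT.1
    rwa [Matrix.IsHermitian, Matrix.conjTranspose_eq_transpose_of_trivial] at this
  rw [inner_mv, h, real_inner_comm]

theorem Problem.D_mv {n d : ℕ} (P : Problem n d) (v : Vec d) : mv P.D v = P.μ • v :=
  smul_one_mv _ _

theorem Problem.D_sq_mv {n d : ℕ} (P : Problem n d) (v : Vec d) :
    mv (P.D ^ 2) v = P.μ ^ 2 • v := by
  rw [sq, mul_mv, P.D_mv, P.D_mv, smul_smul, sq]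

theorem Problem.D_inv_mv {n d : ℕ} (P : Problem n d) (v : Vec d) : mv P.D⁻¹ v = P.μ⁻¹ • v := by
  have : P.D⁻¹ = P.μ⁻¹ • (1 : Matrix (Fin d) (Fin d) ℝ) := by
    apply Matrix.inv_eq_right_inv
    simp [Problem.D, smul_smul, inv_mul_cancel₀ P.μ_pos.ne']
  rw [this, smul_one_mv]

end MatrixVector

/-! ### Product spaces and the operators of the split problem -/

/-- Pairs `(w, β)`. -/
abbrev WB (d : ℕ) : Type := WithLp 2 (Vec d × ℝ)

/-- Triples `(r, (w, β))`. -/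
abbrev RWB (n d : ℕ) : Type := WithLp 2 (Vec n × WB d)

/-- Pairs `(ξ, u)` or `(α, ρ)`. -/
abbrev VecPair (n d : ℕ) : Type := WithLp 2 (Vec n × Vec d)

theorem ext_fst_snd {E F : Type*} {x y : WithLp 2 (E × F)} (h1 : x.fst = y.fst)
    (h2 : x.snd = y.snd) : x = y :=
  WithLp.ofLp_injective 2 (Prod.ext h1 h2)

theorem inner_fst_snd {E F : Type*} [NormedAddCommGroup E] [InnerProductSpace ℝ E]
    [NormedAddCommGroup F] [InnerProductSpace ℝ F] (x y : WithLp 2 (E × F)) :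
    ⟪x, y⟫_ℝ = ⟪x.fst, y.fst⟫_ℝ + ⟪x.snd, y.snd⟫_ℝ :=
  WithLp.prod_inner_apply x y

namespace Problem

variable {n d : ℕ}

/-- The map `(w, β) ↦ Zᵀ w + β y`. -/
def Q (P : Problem n d) : WB d →ₗ[ℝ] Vec n where
  toFun v := mv P.Z.transpose v.fst + v.snd • P.y
  map_add' v w := by simp only [WithLp.add_fst, WithLp.add_snd, mv_add, add_smul]; abel
  map_smul' t v := by
    simp only [WithLp.smul_fst, WithLp.smul_snd, mv_smul, smul_eq_mul, mul_smul, smul_add,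
      RingHom.id_apply]

/-- The adjoint `α ↦ (Z α, ⟨y, α⟩)` of `Q`. -/
def Qadj (P : Problem n d) : Vec n →ₗ[ℝ] WB d where
  toFun α := WithLp.toLp 2 (mv P.Z α, ⟪P.y, α⟫_ℝ)
  map_add' v w := ext_fst_snd (mv_add _ _ _) (inner_add_right _ _ _)
  map_smul' t v := ext_fst_snd (mv_smul _ _ _) (by simp [inner_smul_right])

theorem Q_apply (P : Problem n d) (v : WB d) : P.Q v = mv P.Z.transpose v.fst + v.snd • P.y := rfl

theorem Qadj_fst (P : Problem n d) (α : Vec n) : (P.Qadj α).fst = mv P.Z α := rfl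

theorem Qadj_snd (P : Problem n d) (α : Vec n) : (P.Qadj α).snd = ⟪P.y, α⟫_ℝ := rfl

theorem inner_Qadj (P : Problem n d) (α : Vec n) (v : WB d) :
    ⟪P.Qadj α, v⟫_ℝ = ⟪α, P.Q v⟫_ℝ := by
  rw [inner_fst_snd, Q_apply, Qadj_fst, Qadj_snd, inner_mv, inner_add_right, inner_smul_right,
    real_inner_comm α P.y]
  simp

/-- The map `w ↦ (w, 0)`. -/
def inW (d : ℕ) : Vec d →ₗ[ℝ] WB d where
  toFun w := WithLp.toLp 2 (w, 0)
  map_add' v w := ext_fst_snd rfl (by simp)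
  map_smul' t v := ext_fst_snd rfl (by simp)

theorem inW_fst (w : Vec d) : (inW d w).fst = w := rfl

theorem inW_snd (w : Vec d) : (inW d w).snd = 0 := rfl

theorem inner_inW (w : Vec d) (v : WB d) : ⟪inW d w, v⟫_ℝ = ⟪w, v.fst⟫_ℝ := by
  rw [inner_fst_snd, inW_fst, inW_snd, inner_zero_left, add_zero]

theorem y_ne_zero_coord (P : Problem n d) (i : Fin n) : P.y i ≠ 0 := by
  rcases P.y_label i with h | h <;> rw [h] <;> norm_num

/-- On an empty index set the sup norm of `e` would be `0` instead of `1`. -/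
theorem n_pos (P : Problem n d) : 0 < n := by
  rcases Nat.eq_zero_or_pos n with rfl | h
  · have := P.e_norm
    rw [Subsingleton.elim (WithLp.ofLp P.e) 0, norm_zero] at this
    norm_num at this
  · exact h

theorem y_ne_zero (P : Problem n d) : P.y ≠ 0 := fun h => by
  apply P.y_ne_zero_coord ⟨0, P.n_pos⟩
  rw [h]; rfl

/-- The matrix `A` of the linear system for `(w, β)`. -/
def sysMap (P : Problem n d) (T : Matrix (Fin d) (Fin d) ℝ) : WB d →ₗ[ℝ] WB d :=
  P.Qadj ∘ₗ P.Q
    + inW d ∘ₗ (P.μ ^ 2 • LinearMap.id + Matrix.toEuclideanLin T) ∘ₗ WithLp.fstₗ 2 ℝ (Vec d) ℝ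

theorem sysMap_apply (P : Problem n d) (T : Matrix (Fin d) (Fin d) ℝ) (v : WB d) :
    P.sysMap T v = P.Qadj (P.Q v) + inW d (P.μ ^ 2 • v.fst + mv T v.fst) := rfl

theorem inner_sysMap (P : Problem n d) (T : Matrix (Fin d) (Fin d) ℝ) (v w : WB d) :
    ⟪P.sysMap T v, w⟫_ℝ = ⟪P.Q v, P.Q w⟫_ℝ + (P.μ ^ 2 * ⟪v.fst, w.fst⟫_ℝ
      + ⟪mv T v.fst, w.fst⟫_ℝ) := by
  rw [sysMap_apply, inner_add_left, inner_Qadj, inner_inW, inner_add_left, inner_smul_left,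
    conj_trivial]

theorem sysMap_symm (P : Problem n d) {T : Matrix (Fin d) (Fin d) ℝ} (hT : T.PosSemidef)
    (v w : WB d) : ⟪P.sysMap T v, w⟫_ℝ = ⟪P.sysMap T w, v⟫_ℝ := by
  rw [inner_sysMap, inner_sysMap, real_inner_comm, real_inner_comm w.fst, inner_mv_comm hT]

/-- If the form vanishes, the `μ ^ 2` term kills `w`, and then `β y = 0` with `y ≠ 0` kills `β`. -/
theorem sysMap_pos (P : Problem n d) {T : Matrix (Fin d) (Fin d) ℝ} (hT : T.PosSemidef)
    {v : WB d} (hv : v ≠ 0) : 0 < ⟪P.sysMap T v, v⟫_ℝ := by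
  rw [inner_sysMap, real_inner_self_eq_norm_sq, real_inner_self_eq_norm_sq]
  have h1 := inner_mv_self_nonneg hT v.fst
  have hμ := P.μ_pos
  by_contra! h
  have h2 : 0 ≤ ‖P.Q v‖ ^ 2 := by positivity
  have h3 : 0 ≤ P.μ ^ 2 * ‖v.fst‖ ^ 2 := by positivity
  have h4 : P.μ ^ 2 * ‖v.fst‖ ^ 2 = 0 := by linarith
  have h5 : ‖P.Q v‖ ^ 2 = 0 := by linarith
  have h6 : v.fst = 0 := by simpa [hμ.ne'] using h4
  have h7 : P.Q v = 0 := by simpa using h5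
  rw [Q_apply, h6, mv, map_zero, zero_add, smul_eq_zero] at h7
  exact hv (ext_fst_snd h6 (h7.resolve_right P.y_ne_zero))

theorem sysMap_injective (P : Problem n d) {T : Matrix (Fin d) (Fin d) ℝ} (hT : T.PosSemidef) :
    Function.Injective (P.sysMap T) := by
  rw [injective_iff_map_eq_zero]
  intro v h
  by_contra hv
  have := P.sysMap_pos hT hv
  rw [h, inner_zero_left] at this
  exact this.false

/-- The inverse of `sysMap`. -/
def sysInv (P : Problem n d) {T : Matrix (Fin d) (Fin d) ℝ} (hT : T.PosSemidef) :
    WB d →ₗ[ℝ] WB d :=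
  (LinearEquiv.ofInjectiveEndo (P.sysMap T) (P.sysMap_injective hT)).symm

theorem sysMap_sysInv (P : Problem n d) {T : Matrix (Fin d) (Fin d) ℝ} (hT : T.PosSemidef)
    (v : WB d) : P.sysMap T (P.sysInv hT v) = v :=
  (LinearEquiv.ofInjectiveEndo (P.sysMap T) (P.sysMap_injective hT)).apply_symm_apply v

theorem sysInv_sysMap (P : Problem n d) {T : Matrix (Fin d) (Fin d) ℝ} (hT : T.PosSemidef)
    (v : WB d) : P.sysInv hT (P.sysMap T v) = v :=
  (LinearEquiv.ofInjectiveEndo (P.sysMap T) (P.sysMap_injective hT)).symm_apply_apply v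

theorem sysInv_symm (P : Problem n d) {T : Matrix (Fin d) (Fin d) ℝ} (hT : T.PosSemidef)
    (v w : WB d) : ⟪P.sysInv hT v, w⟫_ℝ = ⟪P.sysInv hT w, v⟫_ℝ := by
  have := P.sysMap_symm hT (P.sysInv hT w) (P.sysInv hT v)
  rw [sysMap_sysInv, sysMap_sysInv] at this
  rw [real_inner_comm, this, real_inner_comm]

theorem sysInv_pos (P : Problem n d) {T : Matrix (Fin d) (Fin d) ℝ} (hT : T.PosSemidef)
    {v : WB d} (hv : v ≠ 0) : 0 < ⟪P.sysInv hT v, v⟫_ℝ := by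
  have h0 : P.sysInv hT v ≠ 0 := fun h => hv (by rw [← P.sysMap_sysInv hT v, h, map_zero])
  have := P.sysMap_pos hT h0
  rwa [sysMap_sysInv, real_inner_comm] at this

/-- The operator `(r, (w, β)) ↦ (Zᵀ w + β y - r, D w)`. -/
def opF (P : Problem n d) : RWB n d →ₗ[ℝ] VecPair n d where
  toFun x := WithLp.toLp 2 (P.Q x.snd - x.fst, P.μ • x.snd.fst)
  map_add' v w := ext_fst_snd (by simp; abel) (by simp)
  map_smul' t v := ext_fst_snd (by simp [smul_sub]) (by simp [smul_comm P.μ t])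

/-- The adjoint of `opF`. -/
def opFadj (P : Problem n d) : VecPair n d →ₗ[ℝ] RWB n d where
  toFun l := WithLp.toLp 2 (-l.fst, P.Qadj l.fst + inW d (P.μ • l.snd))
  map_add' v w := ext_fst_snd (by simp; abel) (by simp; abel)
  map_smul' t v := ext_fst_snd (by simp) (by simp [smul_comm P.μ t])

/-- The operator `(ξ, u) ↦ (ξ, -D u)`. -/
def opG (P : Problem n d) : VecPair n d →ₗ[ℝ] VecPair n d where
  toFun x := WithLp.toLp 2 (x.fst, -(P.μ • x.snd))
  map_add' v w := ext_fst_snd (by simp) (by simp; abel)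
  map_smul' t v := ext_fst_snd (by simp) (by simp [smul_comm P.μ t])

/-- The semi-proximal term induced by the symmetric Gauss-Seidel sweep. -/
def opS (P : Problem n d) (A : Params d) : RWB n d →ₗ[ℝ] RWB n d where
  toFun x := WithLp.toLp 2 (A.σ • P.Q (P.sysInv A.T_posSemidef (P.Qadj x.fst)),
    A.σ • inW d (mv A.T x.snd.fst))
  map_add' v w := ext_fst_snd (by simp) (by simp [mv_add])
  map_smul' t v := ext_fst_snd (by simp [smul_comm A.σ t]) (by simp [mv_smul, smul_comm A.σ t])

theorem inner_opS (P : Problem n d) (A : Params d) (x x' : RWB n d) :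
    ⟪P.opS A x, x'⟫_ℝ = A.σ * ⟪P.sysInv A.T_posSemidef (P.Qadj x.fst), P.Qadj x'.fst⟫_ℝ
      + A.σ * ⟪mv A.T x.snd.fst, x'.snd.fst⟫_ℝ := by
  rw [inner_fst_snd]
  have h1 : (P.opS A x).fst = A.σ • P.Q (P.sysInv A.T_posSemidef (P.Qadj x.fst)) := rfl
  have h2 : (P.opS A x).snd = A.σ • inW d (mv A.T x.snd.fst) := rfl
  rw [h1, h2, inner_smul_left, inner_smul_left, conj_trivial, inner_inW, real_inner_comm,
    ← inner_Qadj, real_inner_comm]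

/-! ### Subdifferential graphs: monotonicity and closedness -/

/-- The graph of the subdifferential of `(r, w, β) ↦ ∑ θ_q(r_i)`. -/
def graphF (P : Problem n d) : Set (RWB n d × RWB n d) :=
  {p | (∀ i, 0 ≤ p.1.fst i ∧ (p.1.fst i) ^ (P.q + 1) * (-(p.2.fst i)) = P.q) ∧ p.2.snd = 0}

/-- The graph of the subdifferential of `(ξ, u) ↦ C ⟨e, ξ⟩ + δ_{ℝⁿ₊}(ξ) + δ_B(u)`. -/
def graphG (P : Problem n d) : Set (VecPair n d × VecPair n d) :=
  {p | (∀ i, 0 ≤ p.1.fst i ∧ p.2.fst i ≤ P.C * P.e i ∧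
      (P.C * P.e i - p.2.fst i) * p.1.fst i = 0) ∧
    ‖p.1.snd‖ ≤ 1 ∧ ∀ u : Vec d, ‖u‖ ≤ 1 → ⟪p.2.snd, u - p.1.snd⟫_ℝ ≤ 0}

/-- `graphF` is written with `0 ≤ r` and a product equation so that its conditions are closed.
Positivity is not lost: at `r = 0` the product would be `0`, whereas `q > 0`. -/
theorem graphF_pos (P : Problem n d) {p : RWB n d × RWB n d} (hp : p ∈ P.graphF) (i : Fin n) :
    0 < p.1.fst i ∧ p.2.fst i = -(P.q / (p.1.fst i) ^ (P.q + 1)) := by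
  obtain ⟨h0, h1⟩ := hp.1 i
  have hq := P.q_pos
  have hpos : 0 < p.1.fst i := by
    refine h0.lt_of_ne fun h => ?_
    rw [← h, Real.zero_rpow (by linarith), zero_mul] at h1
    linarith
  refine ⟨hpos, ?_⟩
  have := Real.rpow_pos_of_pos hpos (P.q + 1)
  have h2 : P.q / (p.1.fst i) ^ (P.q + 1) = -(p.2.fst i) := by
    rw [div_eq_iff this.ne', mul_comm, h1]
  rw [h2, neg_neg]

theorem mem_graphF (P : Problem n d) {x a : RWB n d} (h0 : ∀ i, 0 < x.fst i)
    (h1 : ∀ i, a.fst i = -(P.q / (x.fst i) ^ (P.q + 1))) (h2 : a.snd = 0) :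
    (x, a) ∈ P.graphF := by
  refine ⟨fun i => ⟨(h0 i).le, ?_⟩, h2⟩
  have := Real.rpow_pos_of_pos (h0 i) (P.q + 1)
  simp only
  rw [h1 i]
  field_simp

theorem inner_eq_sum (a b : Vec n) : ⟪a, b⟫_ℝ = ∑ i, a i * b i := by
  rw [PiLp.inner_apply]
  exact Finset.sum_congr rfl fun i _ => by simp [mul_comm]

theorem graphF_mono (P : Problem n d) : ∀ p ∈ P.graphF, ∀ p' ∈ P.graphF,
    0 ≤ ⟪p.2 - p'.2, p.1 - p'.1⟫_ℝ := by
  intro p hp p' hp'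
  have hq := P.q_pos
  rw [inner_fst_snd, WithLp.sub_snd, hp.2, hp'.2, sub_zero, inner_zero_left, add_zero,
    inner_eq_sum]
  refine Finset.sum_nonneg fun i _ => ?_
  obtain ⟨h0, h1⟩ := P.graphF_pos hp i
  obtain ⟨h0', h1'⟩ := P.graphF_pos hp' i
  simp only [WithLp.sub_fst, PiLp.sub_apply]
  rw [h1, h1']
  rcases le_total (p.1.fst i) (p'.1.fst i) with h | h
  · have h2 := Real.rpow_le_rpow h0.le h (by linarith : 0 ≤ P.q + 1)
    have h3 := div_le_div_of_nonneg_left hq.le (Real.rpow_pos_of_pos h0 (P.q + 1)) h2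
    exact mul_nonneg_of_nonpos_of_nonpos (by linarith) (by linarith)
  · have h2 := Real.rpow_le_rpow h0'.le h (by linarith : 0 ≤ P.q + 1)
    have h3 := div_le_div_of_nonneg_left hq.le (Real.rpow_pos_of_pos h0' (P.q + 1)) h2
    exact mul_nonneg (by linarith) (by linarith)

theorem graphG_mono (P : Problem n d) : ∀ p ∈ P.graphG, ∀ p' ∈ P.graphG,
    0 ≤ ⟪p.2 - p'.2, p.1 - p'.1⟫_ℝ := by
  rintro p ⟨hp1, hp2, hp3⟩ p' ⟨hp1', hp2', hp3'⟩
  rw [inner_fst_snd]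
  refine add_nonneg ?_ ?_
  · rw [inner_eq_sum]
    refine Finset.sum_nonneg fun i _ => ?_
    obtain ⟨a1, a2, a3⟩ := hp1 i
    obtain ⟨b1, b2, b3⟩ := hp1' i
    simp only [WithLp.sub_fst, PiLp.sub_apply]
    nlinarith [mul_nonneg (sub_nonneg.2 a2) b1, mul_nonneg (sub_nonneg.2 b2) a1]
  · have h1 := hp3 _ hp2'
    have h2 := hp3' _ hp2
    rw [WithLp.sub_snd, WithLp.sub_snd]
    simp only [inner_sub_left, inner_sub_right] at h1 h2 ⊢
    linarith

theorem continuous_fst_coord {E : Type*} [TopologicalSpace E] {F : Type*}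
    [NormedAddCommGroup F] {f : E → WithLp 2 (Vec n × F)} (hf : Continuous f) (i : Fin n) :
    Continuous fun x => (f x).fst i :=
  (PiLp.continuous_apply 2 _ i).comp ((WithLp.continuous_fst 2 _ _).comp hf)

theorem graphF_closed (P : Problem n d) : IsClosed P.graphF := by
  have hq := P.q_pos
  have c1 : ∀ i, Continuous fun p : RWB n d × RWB n d => p.1.fst i :=
    fun i => continuous_fst_coord continuous_fst i
  have c2 : ∀ i, Continuous fun p : RWB n d × RWB n d => p.2.fst i :=
    fun i => continuous_fst_coord continuous_snd i
  have c3 : Continuous fun p : RWB n d × RWB n d => p.2.snd :=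
    (WithLp.continuous_snd 2 _ _).comp continuous_snd
  refine IsClosed.inter (s₁ := {p : RWB n d × RWB n d | _}) ?_ (isClosed_eq c3 continuous_const)
  simp only [Set.ofPred_forall]
  refine isClosed_iInter fun i => IsClosed.inter (s₁ := {p : RWB n d × RWB n d | _})
    (isClosed_le continuous_const (c1 i)) (isClosed_eq ?_ continuous_const)
  exact ((c1 i).rpow_const fun _ => Or.inr (by linarith)).mul (c2 i).neg

theorem graphG_closed (P : Problem n d) : IsClosed P.graphG := by
  have c1 : ∀ i, Continuous fun p : VecPair n d × VecPair n d => p.1.fst i :=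
    fun i => continuous_fst_coord continuous_fst i
  have c2 : ∀ i, Continuous fun p : VecPair n d × VecPair n d => p.2.fst i :=
    fun i => continuous_fst_coord continuous_snd i
  have c3 : Continuous fun p : VecPair n d × VecPair n d => p.1.snd :=
    (WithLp.continuous_snd 2 _ _).comp continuous_fst
  have c4 : Continuous fun p : VecPair n d × VecPair n d => p.2.snd :=
    (WithLp.continuous_snd 2 _ _).comp continuous_snd
  have e : P.graphG = (⋂ i, {p | 0 ≤ p.1.fst i} ∩ ({p | p.2.fst i ≤ P.C * P.e i} ∩
      {p | (P.C * P.e i - p.2.fst i) * p.1.fst i = 0})) ∩ ({p | ‖p.1.snd‖ ≤ 1} ∩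
      ⋂ u : Vec d, ⋂ _ : ‖u‖ ≤ 1, {p | ⟪p.2.snd, u - p.1.snd⟫_ℝ ≤ 0}) := by
    ext p
    simp [graphG]
  rw [e]
  refine (isClosed_iInter fun i => (isClosed_le continuous_const (c1 i)).inter
    ((isClosed_le (c2 i) continuous_const).inter (isClosed_eq ?_ continuous_const))).inter
    ((isClosed_le c3.norm continuous_const).inter
      (isClosed_iInter fun u => isClosed_iInter fun _ => isClosed_le ?_ continuous_const))
  · exact (continuous_const.sub (c2 i)).mul (c1 i)
  · exact c4.inner (continuous_const.sub c3)

/-- The inexact sGS-ADMM as a semi-proximal ADMM. -/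
def admm (P : Problem n d) (A : Params d) : ADMM (RWB n d) (VecPair n d) (VecPair n d) where
  F := P.opF
  F' := P.opFadj
  G := P.opG
  G' := P.opG
  S := P.opS A
  σ := A.σ
  τ := A.τ
  Tf := P.graphF
  Tg := P.graphG
  F_adj y l := by
    rw [inner_fst_snd, inner_fst_snd l]
    simp only [opFadj, opF, LinearMap.coe_mk, AddHom.coe_mk, WithLp.toLp_fst, WithLp.toLp_snd,
      inner_add_left, inner_Qadj, inner_inW, inner_sub_right, inner_neg_left, inner_smul_left,
      inner_smul_right, conj_trivial]
    ring
  G_adj z l := by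
    rw [inner_fst_snd, inner_fst_snd]
    simp only [opG, LinearMap.coe_mk, AddHom.coe_mk, WithLp.toLp_fst, WithLp.toLp_snd,
      inner_neg_left, inner_neg_right, inner_smul_left, inner_smul_right, conj_trivial]
  S_symm x x' := by
    rw [inner_opS, inner_opS, sysInv_symm, inner_mv_comm A.T_posSemidef]
  S_nonneg x := by
    rw [inner_opS]
    have h1 := inner_mv_self_nonneg A.T_posSemidef x.snd.fst
    have h2 : 0 ≤ ⟪P.sysInv A.T_posSemidef (P.Qadj x.fst), P.Qadj x.fst⟫_ℝ := by
      by_cases h : P.Qadj x.fst = 0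
      · simp [h]
      · exact (P.sysInv_pos _ h).le
    have := A.σ_pos
    positivity
  F_S_pos x hx := by
    have hσ := A.σ_pos
    rw [inner_opS]
    have h1 := mul_nonneg hσ.le (inner_mv_self_nonneg A.T_posSemidef x.snd.fst)
    -- If `Qadj r ≠ 0`, the `sysInv` term of `S` is already positive. Otherwise `⟪y, r⟫ = 0`, and `F
    -- x = 0` would give `w = 0` and `r = β y`, hence `β = 0` and `x = 0`.
    by_cases h : P.Qadj x.fst = 0
    · have hF : P.opF x ≠ 0 := by
        intro h0
        have e1 : P.Q x.snd - x.fst = 0 := congrArg WithLp.fst h0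
        have e2 : P.μ • x.snd.fst = 0 := congrArg WithLp.snd h0
        have e3 : x.snd.fst = 0 := (smul_eq_zero.1 e2).resolve_left P.μ_pos.ne'
        have e4 : x.fst = x.snd.snd • P.y := by
          rw [← sub_eq_zero.1 e1, Q_apply, e3, mv, map_zero, zero_add]
        have e5 : ⟪P.y, x.fst⟫_ℝ = 0 := congrArg WithLp.snd h
        rw [e4, inner_smul_right, mul_eq_zero, inner_self_eq_zero] at e5
        have e6 := e5.resolve_right P.y_ne_zero
        rw [e6, zero_smul] at e4
        exact hx (ext_fst_snd e4 (ext_fst_snd e3 e6))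
      have : 0 < ‖P.opF x‖ ^ 2 := by positivity
      simp only [h, map_zero, inner_zero_left]
      linarith
    · have h2 := mul_pos hσ (P.sysInv_pos A.T_posSemidef h)
      have := sq_nonneg ‖P.opF x‖
      linarith
  G_inj z hz := by
    have e1 : z.fst = 0 := congrArg WithLp.fst hz
    have e2 : -(P.μ • z.snd) = 0 := congrArg WithLp.snd hz
    exact ext_fst_snd e1 ((smul_eq_zero.1 (neg_eq_zero.1 e2)).resolve_left P.μ_pos.ne')
  σ_pos := A.σ_pos
  τ_pos := A.τ_pos
  τ_sq_lt := by
    have h1 := A.τ_lt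
    have h2 := A.τ_pos
    have h3 : √5 * √5 = (5 : ℝ) := Real.mul_self_sqrt (by norm_num)
    have h4 : 1 < √(5 : ℝ) := Real.lt_sqrt_of_sq_lt (by norm_num)
    -- `τ ^ 2 - τ - 1` factors through the golden ratio and its negative conjugate.
    nlinarith [mul_pos (sub_pos.2 h1) (show 0 < A.τ - (1 - √5) / 2 by linarith)]
  Tf_closed := P.graphF_closed
  Tg_closed := P.graphG_closed
  Tf_mono := P.graphF_mono
  Tg_mono := P.graphG_mono

end Problem
end DWD

end

noncomputable section

namespace DWD
open scoped InnerProductSpace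

/-! ### From the algorithm to a run of the abstract method -/

variable {n d : ℕ}

/-- The primal blocks `(r, (w, β))`. -/
def Primal.fstBlock (x : Primal n d) : RWB n d := WithLp.toLp 2 (x.r, WithLp.toLp 2 (x.w, x.β))

/-- The primal blocks `(ξ, u)`. -/
def Primal.sndBlock (x : Primal n d) : VecPair n d := WithLp.toLp 2 (x.ξ, x.u)

/-- The multipliers as a vector of the product space. -/
def Dual.toVecPair (m : Dual n d) : VecPair n d := WithLp.toLp 2 (m.α, m.ρ)

theorem linRes_eq (P : Problem n d) (A : Params d) (r ξ : Vec n) (u w₀ : Vec d) (m : Dual n d)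
    (w : Vec d) (β : ℝ) :
    WithLp.toLp 2 (linResW P A r ξ u w₀ m w β, linResβ P A r ξ m w β)
      = P.Qadj (r - ξ + A.σ⁻¹ • m.α)
        + Problem.inW d (P.μ ^ 2 • u + P.μ • (A.σ⁻¹ • m.ρ) + mv A.T w₀)
        - P.sysMap A.T (WithLp.toLp 2 (w, β)) := by
  rw [P.sysMap_apply]
  refine ext_fst_snd ?_ ?_
  · simp only [linResW, WithLp.toLp_fst, WithLp.toLp_snd, WithLp.sub_fst, WithLp.add_fst,
      P.Qadj_fst, P.Q_apply, Problem.inW_fst, add_mv, mul_mv, P.D_mv, P.D_sq_mv, mv_add, mv_sub,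
      mv_smul]
    module
  · simp only [linResβ, WithLp.toLp_fst, WithLp.toLp_snd, WithLp.sub_snd, WithLp.add_snd,
      P.Qadj_snd, P.Q_apply, Problem.inW_snd, inner_add_right, inner_sub_right, inner_smul_right,
      inner_mv]
    ring

theorem linResNorm_eq (P : Problem n d) (A : Params d) (r ξ : Vec n) (u w₀ : Vec d) (m : Dual n d)
    (w : Vec d) (β : ℝ) :
    linResNorm P A r ξ u w₀ m w β = ‖(WithLp.toLp 2 (linResW P A r ξ u w₀ m w β,
      linResβ P A r ξ m w β) : WB d)‖ := by
  rw [WithLp.prod_norm_eq_of_L2, linResNorm, WithLp.toLp_fst, WithLp.toLp_snd, Real.norm_eq_abs,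
    sq_abs]

theorem norm_le_of_forall_abs_le {v : Vec n} (hn : 0 < n) {ε : ℝ} (hε : 0 ≤ ε)
    (h : ∀ i, |v i| ≤ ε / √(n : ℝ)) : ‖v‖ ≤ ε := by
  rw [EuclideanSpace.norm_eq]
  apply Real.sqrt_le_iff.2 ⟨hε, ?_⟩
  have hn' : (0 : ℝ) < n := by exact_mod_cast hn
  calc ∑ i, ‖v i‖ ^ 2 ≤ ∑ _i : Fin n, (ε / √(n : ℝ)) ^ 2 :=
        Finset.sum_le_sum fun i _ => by
          have := h i
          rw [Real.norm_eq_abs]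
          gcongr
    _ = ε ^ 2 := by
      rw [Finset.sum_const, Finset.card_univ, Fintype.card_fin, nsmul_eq_mul, div_pow,
        Real.sq_sqrt hn'.le]
      field_simp

theorem norm_le_fst_snd {E F : Type*} [NormedAddCommGroup E] [NormedAddCommGroup F]
    (x : WithLp 2 (E × F)) : ‖x‖ ≤ ‖x.fst‖ + ‖x.snd‖ := by
  rw [WithLp.prod_norm_eq_of_L2]
  apply Real.sqrt_le_iff.2 ⟨by positivity, ?_⟩
  nlinarith [norm_nonneg x.fst, norm_nonneg x.snd]

theorem res_eq (P : Problem n d) (A : Params d) (x : Primal n d) :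
    (P.admm A).R x.fstBlock x.sndBlock = WithLp.toLp 2 (P.res1 x, P.res2 x) := by
  refine ext_fst_snd ?_ ?_
  · change P.Q x.fstBlock.snd - x.r + x.ξ = P.res1 x
    rw [P.Q_apply, Problem.res1]
    change mv P.Z.transpose x.w + x.β • P.y - x.r + x.ξ = _
    abel
  · change P.μ • x.w + -(P.μ • x.u) = P.res2 x
    rw [Problem.res2, P.D_mv, smul_sub, sub_eq_add_neg]

theorem res_mixed_eq (P : Problem n d) (A : Params d) (x x' : Primal n d) :
    (P.admm A).R x'.fstBlock x.sndBlock
      = WithLp.toLp 2 (P.Q x'.fstBlock.snd - x'.r + x.ξ, P.μ • (x'.w - x.u)) := by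
  refine ext_fst_snd rfl ?_
  change P.μ • x'.w + -(P.μ • x.u) = P.μ • (x'.w - x.u)
  rw [smul_sub, sub_eq_add_neg]

theorem exists_norm_le_mul {E F : Type*} [NormedAddCommGroup E] [InnerProductSpace ℝ E]
    [FiniteDimensional ℝ E] [NormedAddCommGroup F] [InnerProductSpace ℝ F] (L : E →ₗ[ℝ] F) :
    ∃ κ, 0 ≤ κ ∧ ∀ v, ‖L v‖ ≤ κ * ‖v‖ :=
  ⟨‖L.toContinuousLinearMap‖, norm_nonneg _, L.toContinuousLinearMap.le_opNorm⟩

/-- The symmetric Gauss-Seidel sweep solves the proximal subproblem of the first block up to a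
perturbation proportional to the tolerance. -/
theorem exists_perturbation (P : Problem n d) (A : Params d) : ∃ c, ∀ (ε : ℝ), 0 ≤ ε →
    ∀ x m x' m', IsStep P A ε x m x' m' → ∃ Δ : RWB n d, ‖Δ‖ ≤ c * ε ∧
      (x'.fstBlock, P.opFadj (m.toVecPair - A.σ • (P.admm A).R x'.fstBlock x.sndBlock)
        - P.opS A (x'.fstBlock - x.fstBlock) + Δ) ∈ P.graphF := by
  have hσ := A.σ_pos
  obtain ⟨K, hK⟩ : ∃ K : WB d →ₗ[ℝ] Vec n, ∀ v, K v = P.Q (P.sysInv A.T_posSemidef v) :=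
    ⟨P.Q ∘ₗ P.sysInv A.T_posSemidef, fun v => rfl⟩
  obtain ⟨κ, hκ, hKκ⟩ := exists_norm_le_mul K
  -- `1` comes from the `r`-step, `6 = 1 + 5` from the difference of the two linear residuals, and
  -- the last `5` from the corrected solve.
  refine ⟨1 + A.σ * (κ * 6) + A.σ * 5, fun ε hε x m x' m' hstep => ?_⟩
  obtain ⟨w₁, β₁, h1a, h1b, h1c, -⟩ := hstep
  rw [linResNorm_eq, linRes_eq] at h1a h1c
  obtain ⟨c₀, hc₀⟩ : ∃ c₀, c₀ = Problem.inW d (P.μ ^ 2 • x.u + P.μ • (A.σ⁻¹ • m.ρ)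
    + mv A.T x.w) := ⟨_, rfl⟩
  obtain ⟨v₁, hv₁⟩ : ∃ v₁ : WB d, v₁ = WithLp.toLp 2 (w₁, β₁) := ⟨_, rfl⟩
  obtain ⟨v', hv'⟩ : ∃ v' : WB d, v' = WithLp.toLp 2 (x'.w, x'.β) := ⟨_, rfl⟩
  rw [← hc₀, ← hv₁] at h1a
  rw [← hc₀, ← hv'] at h1c
  obtain ⟨e₁, he₁⟩ : ∃ e, e = P.Qadj (x.r - x.ξ + A.σ⁻¹ • m.α) + c₀ - P.sysMap A.T v₁ := ⟨_, rfl⟩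
  obtain ⟨e₃, he₃⟩ : ∃ e, e = P.Qadj (x'.r - x.ξ + A.σ⁻¹ • m.α) + c₀ - P.sysMap A.T v' :=
    ⟨_, rfl⟩
  rw [← he₁] at h1a
  rw [← he₃] at h1c
  -- The heart of the Gauss–Seidel reduction: the two linear systems differ only in `r` and in their
  -- residuals. Replacing the predicted `v₁` by the corrected `v'` in the `r`-equation thus creates
  -- the proximal term `σ Q A⁻¹ Qᵀ (r' - r)`, plus an error in `e₁ - e₃`.
  have hv : P.Q v₁ = P.Q v' - K (P.Qadj (x'.r - x.r) + (e₁ - e₃)) := by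
    rw [hK, ← map_sub]
    congr 1
    have h1 : P.Qadj (x'.r - x.r) + (e₁ - e₃) = P.sysMap A.T (v' - v₁) := by
      rw [he₁, he₃, map_sub (P.sysMap A.T)]
      simp only [map_add, map_sub]
      abel
    rw [h1, P.sysInv_sysMap]
    abel
  obtain ⟨t, ht⟩ : ∃ t : Vec n, t = WithLp.toLp 2 (fun i => -(P.q / (x'.r i) ^ (P.q + 1)))
      + A.σ • (x'.r - (P.Q v₁ + x.ξ - A.σ⁻¹ • m.α)) := ⟨_, rfl⟩
  have htn : ‖t‖ ≤ ε := by
    apply norm_le_of_forall_abs_le P.n_pos hε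
    intro i
    have := (h1b i).2
    rw [ht, hv₁]
    exact this
  refine ⟨WithLp.toLp 2 (t - A.σ • K (e₁ - e₃), -(A.σ • e₃)), ?_, ?_⟩
  · refine (norm_le_fst_snd _).trans ?_
    rw [WithLp.toLp_fst, WithLp.toLp_snd, norm_neg, norm_smul, Real.norm_of_nonneg hσ.le]
    have h2 : ‖K (e₁ - e₃)‖ ≤ κ * (6 * ε) := by
      refine (hKκ _).trans (mul_le_mul_of_nonneg_left ?_ hκ)
      refine (norm_sub_le _ _).trans ?_
      linarith
    have h3 : ‖t - A.σ • K (e₁ - e₃)‖ ≤ ε + A.σ * (κ * (6 * ε)) := by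
      refine (norm_sub_le _ _).trans (add_le_add htn ?_)
      rw [norm_smul, Real.norm_of_nonneg hσ.le]
      exact mul_le_mul_of_nonneg_left h2 hσ.le
    have h4 := mul_le_mul_of_nonneg_left h1c hσ.le
    linarith
  · rw [res_mixed_eq]
    have hv'' : x'.fstBlock.snd = v' := hv'.symm
    refine P.mem_graphF (fun i => (h1b i).1) (fun i => ?_) ?_
    · have hvec : -(m.α - A.σ • (P.Q v' - x'.r + x.ξ)) - A.σ • K (P.Qadj (x'.r - x.r))
          + (t - A.σ • K (e₁ - e₃)) = WithLp.toLp 2 (fun i => -(P.q / (x'.r i) ^ (P.q + 1))) := by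
        rw [ht, hv, map_add]
        have : A.σ • A.σ⁻¹ • m.α = m.α := smul_inv_smul₀ hσ.ne' _
        simp only [smul_sub, smul_add, this]
        abel
      rw [hv'']
      have := congrArg (fun v : Vec n => v i) hvec
      simp only [hK] at this ⊢
      exact this
    · rw [hv'']
      change P.Qadj (m.α - A.σ • (P.Q v' - x'.r + x.ξ))
        + Problem.inW d (P.μ • (m.ρ - A.σ • (P.μ • (x'.w - x.u))))
        - A.σ • Problem.inW d (mv A.T (x'.w - x.w)) + -(A.σ • e₃) = 0
      have h5 : v'.fst = x'.w := by rw [hv']; rfl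
      rw [he₃, hc₀, P.sysMap_apply, h5]
      have h6 : A.σ • A.σ⁻¹ • P.Qadj m.α = P.Qadj m.α := smul_inv_smul₀ hσ.ne' _
      have h7 : A.σ • A.σ⁻¹ • Problem.inW d m.ρ = Problem.inW d m.ρ := smul_inv_smul₀ hσ.ne' _
      have h8 : A.σ • P.μ • A.σ⁻¹ • Problem.inW d m.ρ = P.μ • Problem.inW d m.ρ := by
        rw [smul_comm A.σ, h7]
      simp only [map_add, map_sub, map_smul, mv_sub, smul_add, smul_sub, h6, h8]
      module

/-- The projection onto the unit ball satisfies its variational inequality. -/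
theorem inner_sub_proj_le {E : Type*} [NormedAddCommGroup E] [InnerProductSpace ℝ E] {g p : E}
    (hp : p = if ‖g‖ ≤ 1 then g else ‖g‖⁻¹ • g) :
    ‖p‖ ≤ 1 ∧ ∀ u : E, ‖u‖ ≤ 1 → ⟪g - p, u - p⟫_ℝ ≤ 0 := by
  split_ifs at hp with h
  · subst hp
    simp [h]
  · push Not at h
    have h0 : 0 < ‖g‖ := by linarith
    have hn : ‖p‖ = 1 := by rw [hp, norm_smul, norm_inv, norm_norm, inv_mul_cancel₀ h0.ne']
    refine ⟨hn.le, fun u hu => ?_⟩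
    have hg : g - p = (‖g‖ - 1) • p := by
      rw [sub_smul, one_smul]
      congr 1
      rw [hp, smul_inv_smul₀ h0.ne']
    rw [hg, inner_smul_left, conj_trivial, inner_sub_right, real_inner_self_eq_norm_sq, hn]
    have h1 := real_inner_le_norm p u
    rw [hn] at h1
    exact mul_nonpos_of_nonneg_of_nonpos (by linarith) (by linarith)

/-- Given the first block, `ξ` and `u` decouple and `D` is a multiple of the identity, so the
positive part and the ball projection solve the second subproblem exactly. -/
theorem step_mem_graphG (P : Problem n d) (A : Params d) {ε : ℝ} {x m x' m'}
    (h : IsStep P A ε x m x' m') :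
    (x'.sndBlock, P.opG (m.toVecPair - A.σ • (P.admm A).R x'.fstBlock x'.sndBlock))
      ∈ P.graphG := by
  obtain ⟨w₁, β₁, -, -, -, hu, hξ, -⟩ := h
  have hσ := A.σ_pos
  have hμ := P.μ_pos
  rw [res_eq]
  obtain ⟨hu1, hu2⟩ := inner_sub_proj_le hu
  refine ⟨fun i => ?_, hu1, fun u hun => ?_⟩
  · change 0 ≤ x'.ξ i ∧ m.α i - A.σ * P.res1 x' i ≤ P.C * P.e i ∧
      (P.C * P.e i - (m.α i - A.σ * P.res1 x' i)) * x'.ξ i = 0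
    obtain ⟨s, hs⟩ : ∃ s, s = (x'.r - mv P.Z.transpose x'.w - x'.β • P.y + A.σ⁻¹ • m.α
        - (A.σ⁻¹ * P.C) • P.e) i := ⟨_, rfl⟩
    have h1 := hξ i
    rw [← hs] at h1
    -- The dual slack is `σ (max 0 s - s)`: nonnegative, and zero wherever `ξ = s`.
    have h2 : P.C * P.e i - (m.α i - A.σ * P.res1 x' i) = A.σ * (x'.ξ i - s) := by
      rw [hs]
      simp only [Problem.res1, PiLp.sub_apply, PiLp.add_apply, PiLp.smul_apply, smul_eq_mul]
      field_simp
      ring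
    have h3 : s ≤ x'.ξ i := by rw [h1]; exact le_max_right _ _
    have h4 : 0 ≤ x'.ξ i := by rw [h1]; exact le_max_left _ _
    refine ⟨h4, ?_, ?_⟩
    · have := mul_nonneg hσ.le (sub_nonneg.2 h3)
      linarith
    · rw [h2]
      rcases max_choice 0 s with h5 | h5 <;> rw [h5] at h1 <;> rw [h1] <;> ring
  · change ⟪-(P.μ • (m.ρ - A.σ • P.res2 x')), u - x'.u⟫_ℝ ≤ 0
    have h1 : -(P.μ • (m.ρ - A.σ • P.res2 x'))
        = (A.σ * P.μ ^ 2) • (x'.w - A.σ⁻¹ • mv P.D⁻¹ m.ρ - x'.u) := by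
      rw [Problem.res2, P.D_mv, P.D_inv_mv]
      have h2 : (A.σ * P.μ ^ 2) • A.σ⁻¹ • P.μ⁻¹ • m.ρ = P.μ • m.ρ := by
        rw [smul_smul, smul_smul]
        congr 1
        field_simp
      simp only [smul_sub, h2]
      module
    rw [h1, inner_smul_left, conj_trivial]
    exact mul_nonpos_of_nonneg_of_nonpos (by positivity) (hu2 u hun)

theorem exists_isRun (P : Problem n d) (A : Params d) {x : ℕ → Primal n d} {m : ℕ → Dual n d}
    (hstep : ∀ k, IsStep P A (A.ε k) (x k) (m k) (x (k + 1)) (m (k + 1))) :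
    ∃ (Δ : ℕ → RWB n d) (c : ℝ), (∀ k, ‖Δ k‖ ≤ c * A.ε k) ∧
      (P.admm A).IsRun (fun k => (x k).fstBlock) (fun k => (x k).sndBlock)
        (fun k => (m k).toVecPair) Δ := by
  obtain ⟨c, hc⟩ := exists_perturbation P A
  choose Δ hΔ hmem using fun k => hc (A.ε k) (A.ε_nonneg k) _ _ _ _ (hstep k)
  refine ⟨Δ, c, hΔ, hmem, fun k => step_mem_graphG P A (hstep k), fun k => ?_⟩
  obtain ⟨w₁, β₁, -, -, -, -, -, h1, h2⟩ := hstep k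
  rw [res_eq]
  exact ext_fst_snd h1 h2

/-- Solutions of the KKT system give solutions of the optimality system of the split problem. -/
theorem isSol_of_KKT (P : Problem n d) (A : Params d) {r : Vec n} {w : Vec d} {β : ℝ}
    {ξ α : Vec n} (h : P.KKT r w β ξ α) :
    (P.admm A).IsSol (Primal.fstBlock ⟨r, w, β, ξ, w⟩) (Primal.sndBlock ⟨r, w, β, ξ, w⟩)
      (Dual.toVecPair ⟨α, -(P.μ⁻¹ • mv P.Z α)⟩) := by
  obtain ⟨h1, h2, h3, h4, h5, h6, h7, h8, h9⟩ := h
  have hμ := P.μ_pos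
  -- Stationarity in `w` reads `Z α + D ρ = 0`, which dictates this choice of `ρ`; `u = w` is
  -- dictated by `D (w - u) = 0`.
  have hμZ : P.μ • -(P.μ⁻¹ • mv P.Z α) = -(mv P.Z α) := by
    rw [smul_neg, smul_inv_smul₀ hμ.ne']
  refine ⟨?_, ?_, ?_⟩
  · rw [res_eq]
    refine ext_fst_snd h1 ?_
    change mv P.D (w - w) = 0
    rw [sub_self, P.D_mv, smul_zero]
  · refine P.mem_graphF h3 (fun i => ?_) ?_
    · change -(α i) = _
      rw [h8]; rfl
    · change P.Qadj α + Problem.inW d (P.μ • -(P.μ⁻¹ • mv P.Z α)) = 0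
      rw [hμZ]
      refine ext_fst_snd ?_ ?_
      · rw [WithLp.add_fst, P.Qadj_fst, Problem.inW_fst, add_neg_cancel]; rfl
      · rw [WithLp.add_snd, P.Qadj_snd, Problem.inW_snd, h2, add_zero]; rfl
  · have hcompl : ∀ i, (P.C * P.e i - α i) * ξ i = 0 := by
      rw [Problem.inner_eq_sum, Finset.sum_eq_zero_iff_of_nonneg] at h7
      · exact fun i => h7 i (Finset.mem_univ i)
      · exact fun i _ => mul_nonneg (sub_nonneg.2 (h5 i)) (h6 i)
    refine ⟨fun i => ⟨h6 i, h5 i, hcompl i⟩, ?_, fun u hu => ?_⟩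
    · change ‖w‖ ≤ 1
      rcases h9 with ⟨hz, hw⟩ | ⟨-, hw⟩
      · rw [hw, norm_smul, norm_inv, norm_norm, inv_mul_cancel₀ (norm_ne_zero_iff.2 hz)]
      · nlinarith [norm_nonneg w]
    · change ⟪-(P.μ • -(P.μ⁻¹ • mv P.Z α)), u - w⟫_ℝ ≤ 0
      rw [hμZ, neg_neg]
      rcases h9 with ⟨hz, hw⟩ | ⟨hz, -⟩
      · have hz' : 0 < ‖mv P.Z α‖ := norm_pos_iff.2 hz
        have e1 : ⟪mv P.Z α, w⟫_ℝ = ‖mv P.Z α‖ := by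
          rw [hw, inner_smul_right, real_inner_self_eq_norm_sq]
          field_simp
        have e2 := real_inner_le_norm (mv P.Z α) u
        rw [inner_sub_right, e1]
        nlinarith
      · rw [hz, inner_zero_left]

/-! ### Saddle points and optimality -/

section Optimality

theorem coe_sum_ereal {ι : Type*} (s : Finset ι) (f : ι → ℝ) :
    ((∑ i ∈ s, f i : ℝ) : EReal) = ∑ i ∈ s, (f i : EReal) := by
  classical
  induction s using Finset.induction_on with
  | empty => simp
  | insert a s ha ih => rw [Finset.sum_insert ha, Finset.sum_insert ha, EReal.coe_add, ih]

/-- The tangent line bound for `t ↦ 1 / t ^ q`. -/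
theorem tangent_le_one_div_rpow {q r t : ℝ} (hq : 0 < q) (hr : 0 < r) (ht : 0 < t) :
    1 / r ^ q - q / r ^ (q + 1) * (t - r) ≤ 1 / t ^ q := by
  -- With `s = t / r`, combine `log s ≤ s - 1` with `1 + v ≤ exp v` at `v = -q log s`.
  have h1 : 1 - q * (t / r - 1) ≤ r ^ q / t ^ q := by
    have hlog := Real.log_le_sub_one_of_pos (div_pos ht hr)
    have hexp := Real.add_one_le_exp (Real.log (t / r) * (-q))
    rw [← Real.rpow_def_of_pos (div_pos ht hr), Real.rpow_neg (div_pos ht hr).le,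
      Real.div_rpow ht.le hr.le, inv_div] at hexp
    nlinarith
  have hrq := Real.rpow_pos_of_pos hr q
  have htq := Real.rpow_pos_of_pos ht q
  have h2 : 1 / r ^ q - q / r ^ (q + 1) * (t - r) = (1 - q * (t / r - 1)) / r ^ q := by
    rw [Real.rpow_add hr, Real.rpow_one]
    field_simp
  rw [h2, div_le_div_iff₀ hrq htq, one_mul]
  rwa [le_div_iff₀ htq] at h1

theorem tangent_le_theta {q r : ℝ} (hq : 0 < q) (hr : 0 < r) (t : ℝ) :
    ((1 / r ^ q - q / r ^ (q + 1) * (t - r) : ℝ) : EReal) ≤ theta q t := by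
  unfold theta
  split_ifs with ht
  · exact EReal.coe_le_coe_iff.2 (tangent_le_one_div_rpow hq hr ht)
  · exact le_top

theorem coe_le_infIndicator {E : Type*} {S : Set E} {x : E} {c : ℝ} (h : x ∈ S → c ≤ 0) :
    (c : EReal) ≤ infIndicator S x := by
  unfold infIndicator
  split_ifs with hx
  · exact_mod_cast h hx
  · exact le_top

theorem objective_eq (P : Problem n d) {x : Primal n d} (hr : ∀ i, 0 < x.r i) (hu : ‖x.u‖ ≤ 1)
    (hξ : ∀ i, 0 ≤ x.ξ i) :
    P.objective x = ((∑ i, 1 / (x.r i) ^ P.q + P.C * ⟪P.e, x.ξ⟫_ℝ : ℝ) : EReal) := by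
  have h1 : infIndicator (Metric.closedBall (0 : Vec d) 1) x.u = 0 :=
    if_pos (mem_closedBall_zero_iff.2 hu)
  have h2 : infIndicator {ξ : Vec n | ∀ i, 0 ≤ ξ i} x.ξ = 0 := if_pos hξ
  rw [Problem.objective, h1, h2, add_zero, add_zero, EReal.coe_add, coe_sum_ereal]
  congr 1
  exact Finset.sum_congr rfl fun i _ => if_pos (hr i)

/-- A solution of the optimality system is a primal-dual optimal pair. -/
theorem isOptimal_of_isSol (P : Problem n d) (A : Params d) {x : Primal n d} {m : Dual n d}
    (h : (P.admm A).IsSol x.fstBlock x.sndBlock m.toVecPair) :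
    P.IsOptimal x ∧ P.IsDualOptimal m := by
  obtain ⟨hR, hF, hξ, hu, hN⟩ := h
  rw [res_eq] at hR
  have hr1 : P.res1 x = 0 := congrArg WithLp.fst hR
  have hr2 : P.res2 x = 0 := congrArg WithLp.snd hR
  have hr : ∀ i, 0 < x.r i := fun i => (P.graphF_pos hF i).1
  have hα : ∀ i, m.α i = P.q / (x.r i) ^ (P.q + 1) := fun i => by
    have h1 : -(m.α i) = -(P.q / (x.r i) ^ (P.q + 1)) := (P.graphF_pos hF i).2
    linarith
  have hQ : P.Qadj m.α + Problem.inW d (P.μ • m.ρ) = 0 := hF.2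
  change ∀ i, 0 ≤ x.ξ i ∧ m.α i ≤ P.C * P.e i ∧ (P.C * P.e i - m.α i) * x.ξ i = 0 at hξ
  change ‖x.u‖ ≤ 1 at hu
  change ∀ u : Vec d, ‖u‖ ≤ 1 → ⟪-(P.μ • m.ρ), u - x.u⟫_ℝ ≤ 0 at hN
  have hadj : ∀ v : WB d, ⟪m.α, P.Q v⟫_ℝ = -⟪P.μ • m.ρ, v.fst⟫_ℝ := fun v => by
    have h1 := congrArg (fun z => ⟪z, v⟫_ℝ) hQ
    simp only [inner_add_left, P.inner_Qadj, Problem.inner_inW, inner_zero_left] at h1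
    linarith
  obtain ⟨o, ho⟩ : ∃ o : ℝ, o = ∑ i, 1 / (x.r i) ^ P.q + P.C * ⟪P.e, x.ξ⟫_ℝ := ⟨_, rfl⟩
  have hobj : P.objective x = o := by rw [ho]; exact objective_eq P hr hu fun i => (hξ i).1
  have hwu : x.w = x.u := by
    rw [Problem.res2, P.D_mv] at hr2
    exact sub_eq_zero.1 ((smul_eq_zero.1 hr2).resolve_left P.μ_pos.ne')
  have hcompl : ⟪m.α, x.ξ⟫_ℝ = P.C * ⟪P.e, x.ξ⟫_ℝ := by
    rw [Problem.inner_eq_sum, Problem.inner_eq_sum, Finset.mul_sum]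
    exact Finset.sum_congr rfl fun i _ => by linarith [(hξ i).2.2]
  have hres : ∀ x' : Primal n d, ⟪m.α, P.res1 x'⟫_ℝ
      = -⟪P.μ • m.ρ, x'.w⟫_ℝ + ⟪m.α, x'.ξ⟫_ℝ - ⟪m.α, x'.r⟫_ℝ := fun x' => by
    have h1 : ⟪m.α, P.Q x'.fstBlock.snd⟫_ℝ = -⟪P.μ • m.ρ, x'.w⟫_ℝ := hadj _
    rw [← h1, ← inner_add_right, ← inner_sub_right]
    rfl
  have hres2 : ∀ x' : Primal n d, ⟪m.ρ, P.res2 x'⟫_ℝ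
      = ⟪P.μ • m.ρ, x'.w⟫_ℝ - ⟪P.μ • m.ρ, x'.u⟫_ℝ := fun x' => by
    rw [Problem.res2, P.D_mv, inner_smul_right, inner_smul_left, inner_smul_left, inner_sub_right,
      conj_trivial, mul_sub]
  -- One half of the saddle point: `x` minimizes the Lagrangian at `m`, with value `o`. Each term of
  -- the objective is bounded below by its affine minorant from the inclusions, and the linear parts
  -- add up to the constraint terms.
  have hlow : ∀ x' : Primal n d,
      ((o + (⟪m.α, P.res1 x'⟫_ℝ + ⟪m.ρ, P.res2 x'⟫_ℝ) : ℝ) : EReal) ≤ P.objective x' := by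
    intro x'
    have b1 : ((∑ i, (1 / (x.r i) ^ P.q - P.q / (x.r i) ^ (P.q + 1) * (x'.r i - x.r i)) : ℝ)
        : EReal) ≤ ∑ i, theta P.q (x'.r i) := by
      rw [coe_sum_ereal]
      exact Finset.sum_le_sum fun i _ => tangent_le_theta P.q_pos (hr i) _
    have b2 : ((⟪-(P.μ • m.ρ), x'.u - x.u⟫_ℝ : ℝ) : EReal) ≤
        infIndicator (Metric.closedBall (0 : Vec d) 1) x'.u :=
      coe_le_infIndicator fun hx => hN _ (mem_closedBall_zero_iff.1 hx)
    have b3 : ((⟪m.α, x'.ξ⟫_ℝ - P.C * ⟪P.e, x'.ξ⟫_ℝ : ℝ) : EReal) ≤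
        infIndicator {ξ : Vec n | ∀ i, 0 ≤ ξ i} x'.ξ := by
      refine coe_le_infIndicator fun hx => ?_
      rw [Problem.inner_eq_sum, Problem.inner_eq_sum, Finset.mul_sum, sub_nonpos]
      refine Finset.sum_le_sum fun i _ => ?_
      have := mul_le_mul_of_nonneg_right (hξ i).2.1 (hx i)
      linarith
    have b4 := add_le_add (add_le_add (add_le_add b1
      (le_refl ((P.C * ⟪P.e, x'.ξ⟫_ℝ : ℝ) : EReal))) b2) b3
    rw [← EReal.coe_add, ← EReal.coe_add, ← EReal.coe_add] at b4
    refine le_trans (le_of_eq ?_) b4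
    congr 1
    have e1 : ∑ i, (1 / (x.r i) ^ P.q - P.q / (x.r i) ^ (P.q + 1) * (x'.r i - x.r i))
        = ∑ i, 1 / (x.r i) ^ P.q - (⟪m.α, x'.r⟫_ℝ - ⟪m.α, x.r⟫_ℝ) := by
      rw [← inner_sub_right, Problem.inner_eq_sum, ← Finset.sum_sub_distrib]
      exact Finset.sum_congr rfl fun i _ => by rw [← hα i]; rfl
    have e2 := hres x
    rw [hr1, inner_zero_right, hwu] at e2
    rw [e1, hres x', hres2 x', ho, inner_neg_left, inner_sub_right]
    linarith
  -- The other half: at the feasible `x` the multipliers play no role, so `o` bounds every dual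
  -- value from above.
  have hlag : ∀ m', P.lagrangian x m' = o := fun m' => by
    rw [Problem.lagrangian, hr1, hr2, inner_zero_right, inner_zero_right, add_zero, hobj,
      EReal.coe_zero, sub_zero]
  have hdual : (o : EReal) ≤ P.dualFunction m := by
    refine le_iInf fun x' => ?_
    rw [Problem.lagrangian, EReal.le_sub_iff_add_le (Or.inl (EReal.coe_ne_bot _))
      (Or.inl (EReal.coe_ne_top _)), ← EReal.coe_add]
    exact hlow x'
  refine ⟨⟨⟨⟨hr1, hr2⟩, ?_⟩, fun x' hx' => ?_⟩, ?_, fun m' => ?_⟩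
  · rw [hobj]; exact EReal.coe_lt_top o
  · have := hlow x'
    rw [hx'.1, hx'.2, inner_zero_right, inner_zero_right, add_zero, add_zero] at this
    rwa [hobj]
  · exact (EReal.bot_lt_coe o).trans_le hdual
  · exact ((iInf_le _ x).trans_eq (hlag m')).trans hdual

end Optimality

end DWD

end

theorem mainTheorem3 {n d : ℕ} (P : DWD.Problem n d) (A : DWD.Params d)
    (hKKT : ∃ (r : DWD.Vec n) (w : DWD.Vec d) (β : ℝ) (ξ α : DWD.Vec n), P.KKT r w β ξ α)
    (x : ℕ → DWD.Primal n d) (m : ℕ → DWD.Dual n d) (hgen : DWD.IsGenerated P A x m) :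
    (∃ xs : DWD.Primal n d, P.IsOptimal xs ∧
      Tendsto (fun k => (x k).r) atTop (𝓝 xs.r) ∧
      Tendsto (fun k => (x k).w) atTop (𝓝 xs.w) ∧
      Tendsto (fun k => (x k).β) atTop (𝓝 xs.β) ∧
      Tendsto (fun k => (x k).ξ) atTop (𝓝 xs.ξ) ∧
      Tendsto (fun k => (x k).u) atTop (𝓝 xs.u)) ∧
    (∃ ms : DWD.Dual n d, P.IsDualOptimal ms ∧
      Tendsto (fun k => (m k).α) atTop (𝓝 ms.α) ∧
      Tendsto (fun k => (m k).ρ) atTop (𝓝 ms.ρ)) := by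
  obtain ⟨r, w, β, ξ, α, hK⟩ := hKKT
  obtain ⟨Δ, c, hΔ, hrun⟩ := DWD.exists_isRun P A hgen.step
  obtain ⟨ys, zs, ls, hs, hy, hz, hl⟩ := (P.admm A).exists_isSol_tendsto
    ⟨_, _, _, DWD.isSol_of_KKT P A hK⟩ hrun hΔ (A.ε_summable.mul_left c)
  -- Splitting the limit into its components and regrouping them returns it definitionally, so `hs`
  -- applies as it is.
  obtain ⟨h1, h2⟩ := DWD.isOptimal_of_isSol P A
    (x := ⟨ys.fst, ys.snd.fst, ys.snd.snd, zs.fst, zs.snd⟩) (m := ⟨ls.fst, ls.snd⟩) hs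
  have hv := ((WithLp.continuous_snd 2 _ _).tendsto ys).comp hy
  exact ⟨⟨_, h1, ((WithLp.continuous_fst 2 _ _).tendsto ys).comp hy,
      ((WithLp.continuous_fst 2 _ _).tendsto ys.snd).comp hv,
      ((WithLp.continuous_snd 2 _ _).tendsto ys.snd).comp hv,
      ((WithLp.continuous_fst 2 _ _).tendsto zs).comp hz,
      ((WithLp.continuous_snd 2 _ _).tendsto zs).comp hz⟩,
    ⟨_, h2, ((WithLp.continuous_fst 2 _ _).tendsto ls).comp hl,
      ((WithLp.continuous_snd 2 _ _).tendsto ls).comp hl⟩⟩
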